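/- Let $\Lambda>0$. There are constants $\tilde c_1,\tilde c_2,\ldots<\infty$, with $\tilde c_l$ depending only on $l$ and $\Lambda$, such that the following holds. Let $(\mathbf M,g)$ be a smooth finite-dimensional Riemannian manifold (without boundary) with Levi-Civita connection $\nabla$ and curvature tensor $R$, which is locally symmetric, i.e. $\nabla R=0$, and satisfies Condition $(\Lambda)$: $R(X,Y,Z,W)=\langle R(X,Y)Z,W\rangle\le\Lambda$ for all unit vectors $X,Y,Z,W$ tangent to $\mathbf M$ at a common point. Let $J\subset\mathbb R$ be an interval and let $\gamma:\mathbf S^1\times J\to\mathbf M$ be a curve shortening flow, i.e. a smooth map such that every $\gamma_t=\gamma(\cdot,t)$ is an immersion and $$\frac{\partial\gamma}{\partial t}=\frac{DT}{\partial s},$$ where, with $u$ the angular parameter on $\mathbf S^1$ and $v=|\partial\gamma/\partial u|$, $T=\frac1v\frac{\partial\gamma}{\partial u}$ is the unit tangent vector and $\frac{D}{\partial s}=\frac1v\nabla_u$ is covariant differentiation along $\gamma_t$ with respect to arc length. Put $k^2=\left|\frac{DT}{\partial s}\right|^2$. Fix $t_0\in J$ and let $M_{t_0}=\max_{\mathbf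 S^1}k^2(\cdot,t_0)$. Then for every $t\in J$ with $$t_0<t\le t_0+\frac1{2\Lambda}\log\Bigl(1+\frac{\Lambda}{4M_{t_0}+\Lambda+1}\Bigr),$$ one has at every point of $\mathbf S^1$, for every integer $l\ge1$, $$\left|\frac{D^lT}{\partial s^l}\right|^2(\cdot,t)\le\frac{\tilde c_l\,M_{t_0}}{(t-t_0)^{l-1}},$$ and moreover $k^2(\cdot,t)\le 2M_{t_0}$. -/

import Mathlib

open Set Bundle Manifold
open scoped ContDiff

noncomputable section

namespace CSF

variable {E : Type*} [NormedAddCommGroup E] [NormedSpace ℝ E]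
  {M : Type*} [TopologicalSpace M] [ChartedSpace E M]

section Charts

variable [RiemannianBundle (fun x : M ↦ TangentSpace 𝓘(ℝ, E) x)]

/-- The Riemannian metric in the chart `φ` at `x₀`: for `y` in the target of `φ`,
`metric x₀ y v w` is the inner product of `dφ⁻¹(y) v` and `dφ⁻¹(y) w`. -/
def metric (x₀ : M) (y : E) : E →L[ℝ] E →L[ℝ] ℝ :=
  ContinuousLinearMap.bilinearComp
    (innerSL ℝ (E := TangentSpace 𝓘(ℝ, E) ((extChartAt 𝓘(ℝ, E) x₀).symm y)))
    (mfderiv 𝓘(ℝ, E) 𝓘(ℝ, E) (extChartAt 𝓘(ℝ, E) x₀).symm y)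
    (mfderiv 𝓘(ℝ, E) 𝓘(ℝ, E) (extChartAt 𝓘(ℝ, E) x₀).symm y)

theorem metric_apply (x₀ : M) (y v w : E) :
    metric x₀ y v w = inner ℝ
      (mfderiv 𝓘(ℝ, E) 𝓘(ℝ, E) (extChartAt 𝓘(ℝ, E) x₀).symm y v)
      (mfderiv 𝓘(ℝ, E) 𝓘(ℝ, E) (extChartAt 𝓘(ℝ, E) x₀).symm y w) :=
  rfl

/-- The functional `z ↦ ½ (∂_v g(w, z) + ∂_w g(v, z) - ∂_z g(v, w))` in the chart at `x₀`
(Christoffel symbols of the first kind). -/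
def christoffelLower (x₀ : M) (y v w : E) : E →L[ℝ] ℝ :=
  (1 / 2 : ℝ) • (fderiv ℝ (metric x₀) y v w + fderiv ℝ (metric x₀) y w v
    - ((fderiv ℝ (metric x₀) y).flip v).flip w)

/-- The Christoffel symbols (of the second kind) of the Levi-Civita connection in the chart at
`x₀`: `christoffel x₀ y v w` has coordinates `Γ^k_{ij}(y) v^i w^j`. The index is raised with the
inverse of the metric, seen as a map from `E` to its dual. -/
def christoffel (x₀ : M) (y v w : E) : E :=
  (metric x₀ y).inverse (christoffelLower x₀ y v w)

/-- The curvature operator `R(v, w) z = ∇_w ∇_v z - ∇_v ∇_w z + ∇_{[v, w]} z` in the chart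
at `x₀`. -/
def curvature (x₀ : M) (y v w z : E) : E :=
  fderiv ℝ (fun y' ↦ christoffel x₀ y' v z) y w - fderiv ℝ (fun y' ↦ christoffel x₀ y' w z) y v
    + christoffel x₀ y w (christoffel x₀ y v z) - christoffel x₀ y v (christoffel x₀ y w z)

/-- The covariant derivative `(∇_a R)(v, w) z` of the curvature in the chart at `x₀`. -/
def covDerivCurvature (x₀ : M) (y a v w z : E) : E :=
  fderiv ℝ (fun y' ↦ curvature x₀ y' v w z) y a + christoffel x₀ y a (curvature x₀ y v w z)
    - curvature x₀ y (christoffel x₀ y a v) w z - curvature x₀ y v (christoffel x₀ y a w) z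
    - curvature x₀ y v w (christoffel x₀ y a z)

variable (E M) in
/-- `M` is locally symmetric: `∇ R = 0`. -/
def IsLocallySymmetric : Prop :=
  ∀ x₀ : M, ∀ y ∈ (extChartAt 𝓘(ℝ, E) x₀).target, ∀ a v w z : E,
    covDerivCurvature x₀ y a v w z = 0

variable (E M) in
/-- Condition (Λ): `R(X, Y, Z, W) = ⟨R(X, Y) Z, W⟩ ≤ Λ` for all unit vectors `X, Y, Z, W` tangent
to `M` at a common point. -/
def ConditionLambda (Λ : ℝ) : Prop :=
  ∀ x₀ : M, ∀ y ∈ (extChartAt 𝓘(ℝ, E) x₀).target, ∀ X Y Z W : E,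
    metric x₀ y X X = 1 → metric x₀ y Y Y = 1 → metric x₀ y Z Z = 1 → metric x₀ y W W = 1 →
    metric x₀ y (curvature x₀ y X Y Z) W ≤ Λ

end Charts

section Curves

/-- The velocity `dc/du` of a curve. -/
def velocity (c : ℝ → M) (u : ℝ) : TangentSpace 𝓘(ℝ, E) (c u) :=
  mfderiv 𝓘(ℝ, ℝ) 𝓘(ℝ, E) c u (1 : ℝ)

/-- The coordinate expression, in the chart at `x₀`, of a vector field along `c`. -/
def coordField (x₀ : M) (c : ℝ → M) (V : ∀ u, TangentSpace 𝓘(ℝ, E) (c u)) (u : ℝ) : E :=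
  mfderiv 𝓘(ℝ, E) 𝓘(ℝ, E) (extChartAt 𝓘(ℝ, E) x₀) (c u) (V u)

variable [RiemannianBundle (fun x : M ↦ TangentSpace 𝓘(ℝ, E) x)]

/-- The covariant derivative `DV/∂u` of a vector field along `c`: in the chart at `c u`, it is
`dV/du + Γ(dc/du, V)`. -/
def covDeriv (c : ℝ → M) (V : ∀ u, TangentSpace 𝓘(ℝ, E) (c u)) (u : ℝ) :
    TangentSpace 𝓘(ℝ, E) (c u) :=
  (mfderiv 𝓘(ℝ, E) 𝓘(ℝ, E) (extChartAt 𝓘(ℝ, E) (c u)) (c u)).inverse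
    (deriv (coordField (c u) c V) u +
      christoffel (c u) (extChartAt 𝓘(ℝ, E) (c u) (c u))
        (coordField (c u) c (velocity c) u) (coordField (c u) c V u))

/-- `DV/∂s = (1/v) DV/∂u`, where `v = |dc/du|` is the speed. -/
def covDerivS (c : ℝ → M) (V : ∀ u, TangentSpace 𝓘(ℝ, E) (c u)) (u : ℝ) :
    TangentSpace 𝓘(ℝ, E) (c u) :=
  ‖velocity (E := E) c u‖⁻¹ • covDeriv c V u

/-- The unit tangent vector `T = (1/v) dc/du`. -/
def unitTangent (c : ℝ → M) (u : ℝ) : TangentSpace 𝓘(ℝ, E) (c u) :=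
  ‖velocity (E := E) c u‖⁻¹ • velocity c u

/-- The iterated covariant derivative `D^l T/∂s^l`. -/
def iterCovDerivT (c : ℝ → M) (l : ℕ) : ∀ u, TangentSpace 𝓘(ℝ, E) (c u) :=
  (covDerivS c)^[l] (unitTangent c)

/-- The closed curve `γ_t`, as a (periodic) function of the angle `u`. -/
def slice (γ : Circle × ℝ → M) (t : ℝ) (u : ℝ) : M := γ (Circle.exp u, t)

variable (E) in
/-- `γ` is a curve shortening flow on the time interval `J`: a smooth family of immersed closed
curves with `∂γ/∂t = DT/∂s`. (At an endpoint belonging to `J` the time derivative is one-sided.) -/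
structure IsCurveShorteningFlow (J : Set ℝ) (γ : Circle × ℝ → M) : Prop where
  smooth : ContMDiffOn ((𝓡 1).prod 𝓘(ℝ, ℝ)) 𝓘(ℝ, E) ∞ γ (univ ×ˢ J)
  immersed : ∀ t ∈ J, ∀ u : ℝ, velocity (E := E) (slice γ t) u ≠ 0
  evolution : ∀ t ∈ J, ∀ u : ℝ,
    HasMFDerivWithinAt 𝓘(ℝ, ℝ) 𝓘(ℝ, E) (fun τ ↦ slice γ τ u) J t
      (ContinuousLinearMap.toSpanSingleton ℝ (iterCovDerivT (E := E) (slice γ t) 1 u))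

end Curves

end CSF

end

/-! Write A_l for D^l T/∂s^l, N_ij for ⟨A_i, A_j⟩ and τ = t - t₀. The speed obeys ∂_t v = -k² v, and
commuting D_t with D/∂s costs k² D/∂s plus a curvature term. Hence D_t A_l = A_{l+2} + Q_l
(`covD_snd`), where Q_l is a sum of monomials ⟨A_{i+1}, A_{j+1}⟩ A_m and R(A_i, A_{j+1}) A_m. Since
∇R = 0, differentiating such a monomial produces only monomials of the same kind, all of the weight
fixed by l (`weight_of_mem_reaction`). Consequently ∂_t|A_l|² = ∂_s²|A_l|² - 2|A_{l+1}|² + 2⟨Q_l,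
A_l⟩.

For l = 1, ⟨A_0, A_2⟩ = -k² and Cauchy–Schwarz give |A_2|² ≥ k⁴. So at a spatial maximum k² grows no
faster than a solution of y' = 2y² + 2Λy, and the admissible time is short enough that this solution
at most doubles (`exists_barrier`, `curvature_le`).

Higher orders follow by induction with Bernstein's method. After parabolic rescaling, the good term
-|A_{l+1}|² absorbs the reaction terms up to lower order quantities (`reaction_estimate`). In
τ^{l+1}|A_{l+1}|² + B τ^l|A_l|² the good term of the second summand pays for differentiating the
power of τ and for the remaining error of the first; the maximum principle
(`le_zero_of_max_principle`) then gives a bound C M τ (`exists_derivative_bound`). Because τΛ ≤ 1/2,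
Λ drops out of the constants.

`IsScalarFlow` separates this analysis from the geometry: it records what is needed about the Gram
functions N_ij. `IsCurveShorteningFlow.isScalarFlow` verifies it in charts. Time derivatives are
available only in the interior of J, so the final time is reached by continuity
(`EstimateSetting.le_right`). -/

noncomputable section

set_option maxSynthPendingDepth 3

namespace CSF

/-! ### Reaction monomials and the scalar system they govern -/

/-- The monomials in the derivatives `A_l = D^l T/∂s^l` occurring in the reaction part of their
evolution equations: `inn i j m` stands for `⟨A_{i+1}, A_{j+1}⟩ A_m` and `curv i j m` for
`R(A_i, A_{j+1}) A_m`. -/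
inductive FlowTerm
  | inn (i j m : ℕ)
  | curv (i j m : ℕ)

/-- The arc length derivative of a monomial, as a list of monomials. -/
def FlowTerm.derivative : FlowTerm → List FlowTerm
  | inn i j m => [inn (i + 1) j m, inn i (j + 1) m, inn i j (m + 1)]
  | curv i j m => [curv (i + 1) j m, curv i (j + 1) m, curv i j (m + 1)]

/-- The reaction part `Q_l` in the evolution equation `D_t A_l = A_{l+2} + Q_l`. -/
def reaction : ℕ → List FlowTerm
  | 0 => [.inn 0 0 0]
  | l + 1 => (reaction l).flatMap FlowTerm.derivative ++ [.inn 0 0 (l + 1), .curv 0 0 l]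

/-- The weight of a monomial: the number of derivatives, up to a shift. -/
def FlowTerm.weight : FlowTerm → ℕ
  | inn i j m => i + j + m
  | curv i j m => i + j + m + 1

/-- Each differentiation raises the weight by one, and the two commutator terms added at order l + 1
have that weight. This homogeneity is what makes the powers of τ match in `reaction_estimate`. -/
theorem weight_of_mem_reaction (l : ℕ) : ∀ q ∈ reaction l, q.weight = l := by
  induction l with
  | zero => simp [reaction, FlowTerm.weight]
  | succ l ih =>
    intro q hq
    simp only [reaction, List.mem_append, List.mem_flatMap, List.mem_cons, List.not_mem_nil,
      or_false] at hq
    rcases hq with ⟨r, hr, hq⟩ | rfl | rfl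
    · have hrw := ih r hr
      cases r <;> simp only [FlowTerm.derivative, List.mem_cons, List.not_mem_nil, or_false] at hq
      all_goals
        rcases hq with rfl | rfl | rfl <;> simp only [FlowTerm.weight] at hrw ⊢ <;> omega
    · simp [FlowTerm.weight]
    · simp [FlowTerm.weight]

/-- A bound for the inner product of a monomial with `A_l`, in terms of the Gram matrix
`N i j = ⟨A_i, A_j⟩`. -/
def FlowTerm.bound (Λ : ℝ) (N : ℕ → ℕ → ℝ) (l : ℕ) : FlowTerm → ℝ
  | inn i j m => |N (i + 1) (j + 1)| * |N m l|
  | curv i j m => Λ * (√(N i i) * √(N (j + 1) (j + 1)) * √(N m m) * √(N l l))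

/-- The properties of the functions `G i j u t = ⟨A_i, A_j⟩` and of the speed `v` along a curve
shortening flow that lead to the derivative estimates. -/
structure IsScalarFlow (Λ : ℝ) (J : Set ℝ) (G : ℕ → ℕ → ℝ → ℝ → ℝ) (v : ℝ → ℝ → ℝ) : Prop where
  continuousOn : ∀ i j, ContinuousOn (fun p : ℝ × ℝ ↦ G i j p.1 p.2) (univ ×ˢ J)
  periodic : ∀ i j, ∀ t ∈ J, ∀ u, G i j (u + 2 * Real.pi) t = G i j u t
  symm : ∀ i j u t, G i j u t = G j i u t
  nonneg : ∀ l u t, 0 ≤ G l l u t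
  abs_le : ∀ i j u t, |G i j u t| ≤ √(G i i u t) * √(G j j u t)
  zero_zero : ∀ t ∈ interior J, ∀ u, G 0 0 u t = 1
  zero_one : ∀ t ∈ interior J, ∀ u, G 0 1 u t = 0
  zero_two : ∀ t ∈ interior J, ∀ u, G 0 2 u t = - G 1 1 u t
  speed_pos : ∀ t ∈ interior J, ∀ u, 0 < v u t
  differentiableAt_speed : ∀ t ∈ interior J, ∀ u, DifferentiableAt ℝ (fun u ↦ v u t) u
  hasDerivAt_fst : ∀ i j, ∀ t ∈ interior J, ∀ u,
    HasDerivAt (fun u ↦ G i j u t) (v u t * (G (i + 1) j u t + G i (j + 1) u t)) u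
  hasDerivAt_snd : ∀ l, ∀ t ∈ interior J, ∀ u, ∃ S,
    |S| ≤ ((reaction l).map (FlowTerm.bound Λ (fun i j ↦ G i j u t) l)).sum ∧
    HasDerivAt (fun t ↦ G l l u t) (2 * G (l + 2) l u t + 2 * S) t

/-! ### Maximum principle on a periodic space-time strip -/

section MaximumPrinciple

/-- If the second derivative were positive, the point would be a local minimum as well, so the
function would be locally constant and its second derivative zero. -/
theorem deriv_eq_zero_and_deriv_nonpos_of_max {f f' : ℝ → ℝ} {f'' u : ℝ}
    (h1 : ∀ x, HasDerivAt f (f' x) x) (h2 : HasDerivAt f' f'' u) (hmax : ∀ x, f x ≤ f u) :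
    f' u = 0 ∧ f'' ≤ 0 := by
  have hloc : IsLocalMax f u := Filter.Eventually.of_forall hmax
  have h0 : f' u = 0 := hloc.hasDerivAt_eq_zero (h1 u)
  refine ⟨h0, ?_⟩
  by_contra! hpos
  have hd : deriv f = f' := funext fun x ↦ (h1 x).deriv
  have hmin : IsLocalMin f u := isLocalMin_of_deriv_deriv_pos (by rw [hd, h2.deriv]; exact hpos)
    (by rw [hd, h0]) (h1 u).continuousAt
  have hconst : f =ᶠ[nhds u] fun _ ↦ f u := by
    filter_upwards [hmin] with x hx using le_antisymm (hmax x) hx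
  have hd0 : f' =ᶠ[nhds u] fun _ ↦ 0 := by
    rw [← hd]
    filter_upwards [hconst.eventuallyEq_nhds] with x hx
    rw [hx.deriv_eq]; simp
  have := (h2.congr_of_eventuallyEq hd0.symm).unique (hasDerivAt_const u 0)
  linarith

theorem exists_mem_Icc_of_periodic {f : ℝ → ℝ} (hf : ∀ u, f (u + 2 * Real.pi) = f u) (u : ℝ) :
    ∃ u' ∈ Icc 0 (2 * Real.pi), f u' = f u := by
  have hper : Function.Periodic f (2 * Real.pi) := hf
  obtain ⟨y, hy, h⟩ := hper.exists_mem_Ico₀ (by positivity) u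
  exact ⟨y, Ico_subset_Icc_self hy, h.symm⟩

/-- By periodicity the damped function e^{-(C+1)(t-t₀)} w attains its maximum. If that were
positive, it would occur after t₀ at a spatial maximum of w, where the extra 1 in the exponent makes
the time derivative strictly negative. Then slightly earlier values would be larger. -/
theorem le_zero_of_max_principle {w : ℝ → ℝ → ℝ} {t₀ t₁ C : ℝ}
    (hper : ∀ t ∈ Icc t₀ t₁, ∀ u, w (u + 2 * Real.pi) t = w u t)
    (hcont : ContinuousOn (fun p : ℝ × ℝ ↦ w p.1 p.2) (univ ×ˢ Icc t₀ t₁))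
    (h0 : ∀ u, w u t₀ ≤ 0)
    (h : ∀ t ∈ Ioc t₀ t₁, ∀ u, 0 < w u t → (∀ u', w u' t ≤ w u t) →
      ∃ d, HasDerivAt (w u) d t ∧ d ≤ C * w u t) :
    ∀ t ∈ Icc t₀ t₁, ∀ u, w u t ≤ 0 := by
  intro t ht u
  by_contra! hpos
  set K := Icc 0 (2 * Real.pi) ×ˢ Icc t₀ t₁ with hK
  have hKc : IsCompact K := isCompact_Icc.prod isCompact_Icc
  obtain ⟨u', hu', huu⟩ := exists_mem_Icc_of_periodic (f := fun u ↦ w u t) (hper t ht) u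
  set f : ℝ → ℝ → ℝ := fun u t ↦ Real.exp (-(C + 1) * (t - t₀)) * w u t with hf
  have hfc : ContinuousOn (fun p : ℝ × ℝ ↦ f p.1 p.2) K := by
    refine ContinuousOn.mul (by fun_prop) (hcont.mono ?_)
    exact prod_mono (subset_univ _) subset_rfl
  obtain ⟨⟨u₁, t₂⟩, hmem, hmax⟩ := hKc.exists_isMaxOn ⟨(u', t), hu', ht⟩ hfc
  have hmax' : ∀ x ∈ Icc 0 (2 * Real.pi), ∀ s ∈ Icc t₀ t₁, f x s ≤ f u₁ t₂ := fun x hx s hs ↦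
    hmax (show (x, s) ∈ K from ⟨hx, hs⟩)
  have hfpos : 0 < f u₁ t₂ := by
    refine lt_of_lt_of_le ?_ (hmax' u' hu' t ht)
    have := Real.exp_pos (-(C + 1) * (t - t₀))
    simp only [hf, huu]; positivity
  have hwpos : 0 < w u₁ t₂ := by
    have := Real.exp_pos (-(C + 1) * (t₂ - t₀))
    exact (pos_iff_pos_of_mul_pos hfpos).1 this
  have ht2 : t₂ ∈ Ioc t₀ t₁ := by
    refine ⟨lt_of_le_of_ne hmem.2.1 fun he ↦ ?_, hmem.2.2⟩
    have := h0 u₁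
    rw [he] at this
    linarith
  obtain ⟨d, hd, hdle⟩ := h t₂ ht2 u₁ hwpos fun x ↦ by
    obtain ⟨x', hx', hxx⟩ := exists_mem_Icc_of_periodic (f := fun u ↦ w u t₂) (hper t₂ hmem.2) x
    have := hmax' x' hx' t₂ hmem.2
    simp only [hf, hxx] at this
    exact le_of_mul_le_mul_left this (Real.exp_pos _)
  have hfd : HasDerivAt (f u₁) (Real.exp (-(C + 1) * (t₂ - t₀)) * (d - (C + 1) * w u₁ t₂)) t₂ := by
    have he : HasDerivAt (fun s ↦ Real.exp (-(C + 1) * (s - t₀)))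
        (Real.exp (-(C + 1) * (t₂ - t₀)) * (-(C + 1))) t₂ := by
      have := (((hasDerivAt_id t₂).sub_const t₀).const_mul (-(C + 1))).exp
      simpa using this
    refine (he.mul hd).congr_deriv ?_
    ring
  have hneg : Real.exp (-(C + 1) * (t₂ - t₀)) * (d - (C + 1) * w u₁ t₂) < 0 := by
    have := Real.exp_pos (-(C + 1) * (t₂ - t₀))
    exact mul_neg_of_pos_of_neg this (by linarith)
  have hlm : IsLocalMaxOn (f u₁) (Icc t₀ t₁) t₂ :=
    Filter.eventually_of_mem self_mem_nhdsWithin fun s hs ↦ hmax' u₁ hmem.1 s hs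
  -- Only the backward time direction is needed, so the argument also covers a maximum at the final
  -- time.
  have hcone : t₀ - t₂ ∈ posTangentConeAt (Icc t₀ t₁) t₂ := by
    refine sub_mem_posTangentConeAt_of_segment_subset ?_
    exact (convex_Icc t₀ t₁).segment_subset hmem.2 ⟨le_rfl, ht2.1.le.trans ht2.2⟩
  have := hlm.hasFDerivWithinAt_nonpos hfd.hasFDerivAt.hasFDerivWithinAt hcone
  simp only [ContinuousLinearMap.toSpanSingleton_apply, smul_eq_mul] at this
  nlinarith [ht2.1]

end MaximumPrinciple

/-! ### Absorption of the reaction terms -/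

section ReactionEstimate

theorem mul_four_le {a b c d K ε : ℝ} (hb : 0 ≤ b) (hc : 0 ≤ c) (hd : 0 ≤ d)
    (hε : 0 ≤ ε) (hK : 1 ≤ K) (haK : a ≤ K * ε) (hbK : b ≤ K) (hcK : c ≤ K) :
    a * b * c * d ≤ K ^ 3 * (d ^ 2 + ε ^ 2) := by
  calc a * b * c * d ≤ (K * ε) * K * K * d := by gcongr
    _ = K ^ 3 * (ε * d) := by ring
    _ ≤ K ^ 3 * (d ^ 2 + ε ^ 2) := by
      gcongr
      nlinarith [sq_nonneg (d - ε), sq_nonneg (d + ε)]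

variable {X : ℕ → ℝ} {K ε : ℝ} {l : ℕ}

/-- Here X j stands for τ^{j/2}|A_j|, and ε² for τM. At most one of the three indices i + 1, j + 1,
m reaches l, apart from the excluded case; the other factors are bounded by K. If none reaches l,
the factor of index i + 1 ≥ 1 supplies an ε. The excluded case would give the cubic X_2³, which no
quadratic expression controls. -/
theorem inn_product_le (hX : ∀ j, 0 ≤ X j) (hX0 : X 0 = 1) (hε : 0 ≤ ε) (hε1 : ε ≤ 1) (hK : 1 ≤ K)
    (hl : 2 ≤ l) (hXl : ∀ j, 1 ≤ j → j < l → X j ≤ K * ε) {i j m : ℕ} (hw : i + j + m = l)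
    (hne : ¬ (l = 2 ∧ m = 0 ∧ i = 1)) :
    X (i + 1) * X (j + 1) * X m * X l ≤ K ^ 3 * (X (l + 1) * X l + X l ^ 2 + ε ^ 2) := by
  have hXK : ∀ j, j < l → X j ≤ K := by
    intro j hj
    rcases Nat.eq_zero_or_pos j with rfl | hj0
    · rw [hX0]; exact hK
    · exact (hXl j hj0 hj).trans (by nlinarith)
  have hK0 : 0 ≤ K := by linarith
  have hK2 : K ^ 2 ≤ K ^ 3 := pow_le_pow_right₀ hK (by norm_num)
  have hK1 : K ≤ K ^ 3 := le_self_pow₀ hK (by norm_num)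
  have hX1 := hXK 1 (by omega)
  have n1 := mul_nonneg (hX (l + 1)) (hX l)
  have n2 := sq_nonneg (X l)
  have n3 := sq_nonneg ε
  have hsq : X 1 * X 1 ≤ K ^ 2 := by
    rw [sq]; exact mul_le_mul hX1 hX1 (hX 1) hK0
  -- a product `A * P` with `A ≤ K ^ 3` and `P` one of the summands
  have fin : ∀ A P, A ≤ K ^ 3 → 0 ≤ P → P ≤ X (l + 1) * X l + X l ^ 2 + ε ^ 2 →
      A * P ≤ K ^ 3 * (X (l + 1) * X l + X l ^ 2 + ε ^ 2) := fun A P hA hP hP' ↦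
    mul_le_mul hA hP' hP (by positivity)
  by_cases hi : i = l
  · obtain ⟨rfl, rfl⟩ : j = 0 ∧ m = 0 := by omega
    rw [hi, hX0, zero_add]
    have := fin (X 1) (X (l + 1) * X l) (hX1.trans hK1) n1 (by linarith)
    linarith
  by_cases hj : j = l
  · obtain ⟨rfl, rfl⟩ : i = 0 ∧ m = 0 := by omega
    rw [hj, hX0, zero_add]
    have := fin (X 1) (X (l + 1) * X l) (hX1.trans hK1) n1 (by linarith)
    linarith
  by_cases hm : m = l
  · obtain ⟨rfl, rfl⟩ : i = 0 ∧ j = 0 := by omega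
    rw [hm, zero_add]
    have := fin (X 1 * X 1) (X l ^ 2) (hsq.trans hK2) n2 (by linarith)
    linarith
  by_cases hi1 : i + 1 = l
  · rcases (show (j = 1 ∧ m = 0) ∨ (j = 0 ∧ m = 1) by omega) with ⟨rfl, rfl⟩ | ⟨rfl, rfl⟩
    · have hX2 := hXK 2 (by omega)
      rw [hi1, hX0]
      have := fin (X 2) (X l ^ 2) (hX2.trans hK1) n2 (by linarith)
      norm_num
      linarith
    · rw [hi1, zero_add]
      have := fin (X 1 * X 1) (X l ^ 2) (hsq.trans hK2) n2 (by linarith)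
      linarith
  by_cases hj1 : j + 1 = l
  · rcases (show (i = 1 ∧ m = 0) ∨ (i = 0 ∧ m = 1) by omega) with ⟨rfl, rfl⟩ | ⟨rfl, rfl⟩
    · have hX2 := hXK 2 (by omega)
      rw [hj1, hX0]
      have := fin (X 2) (X l ^ 2) (hX2.trans hK1) n2 (by linarith)
      norm_num
      linarith
    · rw [hj1, zero_add]
      have := fin (X 1 * X 1) (X l ^ 2) (hsq.trans hK2) n2 (by linarith)
      linarith
  · refine (mul_four_le (hX _) (hX _) (hX _) hε hK (hXl _ (by omega) (by omega))
      (hXK _ (by omega)) (hXK _ (by omega))).trans ?_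
    gcongr
    linarith

/-- The index j + 1 is at least 1: either it equals l, leaving X_l², or its factor supplies an ε. -/
theorem curv_product_le (hX : ∀ j, 0 ≤ X j) (hX0 : X 0 = 1) (hε : 0 ≤ ε) (hε1 : ε ≤ 1) (hK : 1 ≤ K)
    (hXl : ∀ j, 1 ≤ j → j < l → X j ≤ K * ε) {i j m : ℕ} (hw : i + j + m + 1 = l) :
    X i * X (j + 1) * X m * X l ≤ K ^ 3 * (X l ^ 2 + ε ^ 2) := by
  have hXK : ∀ j, j < l → X j ≤ K := by
    intro j hj
    rcases Nat.eq_zero_or_pos j with rfl | hj0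
    · rw [hX0]; exact hK
    · exact (hXl j hj0 hj).trans (by nlinarith)
  by_cases hj1 : j + 1 = l
  · obtain ⟨rfl, rfl⟩ : i = 0 ∧ m = 0 := by omega
    rw [hj1, hX0]
    have h1 : 1 ≤ K ^ 3 := one_le_pow₀ hK
    nlinarith [sq_nonneg (X l), sq_nonneg ε]
  · have := mul_four_le (a := X (j + 1)) (hX i) (hX m) (hX l) hε hK (hXl _ (by omega) (by omega))
      (hXK _ (by omega)) (hXK _ (by omega))
    linarith

/-- Two of the four inner product monomials carry the factor ⟨A_0, A_1⟩ = 0; the other two both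
equal ⟨A_1, A_1⟩ A_1. -/
theorem sum_bound_reaction_one {Λ : ℝ} {N : ℕ → ℕ → ℝ} (hN : ∀ l, 0 ≤ N l l) (h00 : N 0 0 = 1)
    (h01 : N 0 1 = 0) :
    ((reaction 1).map (FlowTerm.bound Λ N 1)).sum = 2 * N 1 1 ^ 2 + Λ * N 1 1 := by
  have s1 : √(N 1 1) * √(N 1 1) = N 1 1 := Real.mul_self_sqrt (hN 1)
  simp only [reaction, FlowTerm.derivative, FlowTerm.bound, List.flatMap_cons,
    List.flatMap_nil, List.append_nil, List.cons_append, List.nil_append, List.map_cons,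
    List.map_nil, List.sum_cons, List.sum_nil, zero_add, add_zero, h01, h00, abs_zero, mul_zero,
    abs_of_nonneg (hN 1), Real.sqrt_one, one_mul, mul_one, s1]
  ring

/-- The good term `-A_{l+1}` absorbs the reaction terms in the evolution of `|A_l|^2`. -/
theorem reaction_estimate {l : ℕ} (hl : 1 ≤ l) {K : ℝ} (hK : 1 ≤ K) : ∃ B : ℝ, 0 ≤ B ∧
    ∀ (Λ M τ : ℝ) (N : ℕ → ℕ → ℝ), 0 ≤ Λ → 0 < τ → 0 ≤ M → τ * M ≤ 1 / 8 → τ * Λ ≤ 1 / 2 →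
      (∀ l, 0 ≤ N l l) → (∀ i j, |N i j| ≤ √(N i i) * √(N j j)) → N 0 0 = 1 → N 0 1 = 0 →
      N 0 2 = - N 1 1 → N 1 1 ≤ 2 * M → (∀ j, 1 ≤ j → j < l → τ ^ (j - 1) * N j j ≤ K * M) →
      ∀ S, |S| ≤ ((reaction l).map (FlowTerm.bound Λ N l)).sum →
        τ ^ l * (-2 * N (l + 1) (l + 1) + 2 * S) ≤
          -(τ ^ l * N (l + 1) (l + 1)) + B * (τ ^ (l - 1) * N l l + M) := by
  -- For l = 1 there is no lower order bound to use. Instead k² ≤ 2M and τM ≤ 1/8 make the quartic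
  -- term linear in k².
  rcases hl.eq_or_lt with rfl | hl2
  · refine ⟨2, by norm_num, ?_⟩
    intro Λ M τ N hΛ hτ hM hτM hτΛ hN hCS h00 h01 h02 h11 _ S hS
    rw [sum_bound_reaction_one hN h00 h01] at hS
    have hS' := (abs_le.1 hS).2
    have hN1 := hN 1
    have hN2 := hN 2
    simp only [pow_one, Nat.sub_self, pow_zero, one_mul]
    have a1 : τ * N 1 1 ^ 2 ≤ 1 / 4 * N 1 1 := by
      have : τ * N 1 1 ≤ 1 / 4 := by nlinarith
      nlinarith
    have a2 : τ * Λ * N 1 1 ≤ 1 / 2 * N 1 1 := by nlinarith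
    have a3 : τ * S ≤ τ * (2 * N 1 1 ^ 2 + Λ * N 1 1) := by gcongr
    have a4 := mul_nonneg hτ.le hN2
    norm_num
    nlinarith
  · set n : ℝ := ((reaction l).length : ℝ) with hn
    set A : ℝ := n * K ^ 3 with hA
    have hA0 : 0 ≤ A := by positivity
    refine ⟨A ^ 2 + 2 * A, by positivity, ?_⟩
    intro Λ M τ N hΛ hτ hM hτM hτΛ hN hCS h00 h01 h02 h11 hlow S hS
    set σ := √τ with hσ
    have hσ2 : σ ^ 2 = τ := Real.sq_sqrt hτ.le
    have hσ0 : 0 < σ := Real.sqrt_pos.2 hτ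
    set ε := √(τ * M) with hε
    have hε2 : ε ^ 2 = τ * M := Real.sq_sqrt (by positivity)
    have hε0 : 0 ≤ ε := Real.sqrt_nonneg _
    have hε1 : ε ≤ 1 := by nlinarith
    set X : ℕ → ℝ := fun j ↦ σ ^ j * √(N j j) with hX
    have hX0 : ∀ j, 0 ≤ X j := fun j ↦ by positivity
    have hX00 : X 0 = 1 := by simp [hX, h00]
    have hXsq : ∀ j, X j ^ 2 = τ ^ j * N j j := fun j ↦ by
      simp only [hX]
      rw [mul_pow, Real.sq_sqrt (hN j), ← pow_mul, mul_comm j 2, pow_mul, hσ2]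
    have hXl : ∀ j, 1 ≤ j → j < l → X j ≤ K * ε := by
      intro j h1 h2
      refine abs_le_of_sq_le_sq' ?_ (by positivity) |>.2
      rw [hXsq, mul_pow, hε2]
      obtain ⟨k, rfl⟩ : ∃ k, j = k + 1 := ⟨j - 1, by omega⟩
      have h3 := hlow (k + 1) h1 h2
      rw [Nat.add_sub_cancel] at h3
      calc τ ^ (k + 1) * N (k + 1) (k + 1) = τ * (τ ^ k * N (k + 1) (k + 1)) := by ring
        _ ≤ τ * (K * M) := by gcongr
        _ = K * (τ * M) := by ring
        _ ≤ K ^ 2 * (τ * M) := by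
          gcongr
          nlinarith
    have hterm : ∀ q ∈ reaction l, τ ^ (l + 1) * FlowTerm.bound Λ N l q ≤
        K ^ 3 * (X (l + 1) * X l + X l ^ 2 + ε ^ 2) := by
      intro q hq
      have hwt := weight_of_mem_reaction l q hq
      cases q with
      | inn i j m =>
        simp only [FlowTerm.weight] at hwt
        simp only [FlowTerm.bound]
        -- The exceptional monomial ⟨A_2, A_2⟩ A_0 is paired with A_2. Replacing ⟨A_0, A_2⟩ by -k²
        -- turns the cubic term into |A_1|²|A_2|², which is quadratic in the top order.
        by_cases hex : l = 2 ∧ m = 0 ∧ i = 1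
        · obtain ⟨rfl, rfl, rfl⟩ := hex
          obtain rfl : j = 1 := by omega
          rw [h02, abs_neg, abs_of_nonneg (hN 1), abs_of_nonneg (hN 2)]
          have h1 := hXl 1 le_rfl (by norm_num)
          have e : τ ^ (2 + 1) * (N 2 2 * N 1 1) = X 1 ^ 2 * X 2 ^ 2 := by
            rw [hXsq, hXsq]; ring
          have h2 : X 1 ^ 2 ≤ K ^ 3 := by
            have : X 1 ≤ K := h1.trans (by nlinarith)
            calc X 1 ^ 2 ≤ K ^ 2 := by gcongr
              _ ≤ K ^ 3 := pow_le_pow_right₀ hK (by norm_num)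
          change τ ^ (2 + 1) * (N 2 2 * N 1 1) ≤ _
          rw [e]
          have n1 := mul_nonneg (hX0 3) (hX0 2)
          have n2 := sq_nonneg (X 2)
          have n3 := sq_nonneg ε
          exact mul_le_mul h2 (by norm_num; linarith) n2 (by positivity)
        · refine le_trans ?_ (inn_product_le hX0 hX00 hε0 hε1 hK hl2 hXl hwt hex)
          have c1 := hCS (i + 1) (j + 1)
          have c2 := hCS m l
          calc τ ^ (l + 1) * (|N (i + 1) (j + 1)| * |N m l|)
              ≤ τ ^ (l + 1) * ((√(N (i + 1) (i + 1)) * √(N (j + 1) (j + 1))) *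
                (√(N m m) * √(N l l))) := by gcongr
            _ = X (i + 1) * X (j + 1) * X m * X l := by
              have : τ ^ (l + 1) = σ ^ (i + 1) * σ ^ (j + 1) * σ ^ m * σ ^ l := by
                rw [← hσ2, ← pow_mul, ← pow_add, ← pow_add, ← pow_add]
                congr 1
                omega
              rw [this]; simp only [hX]; ring
      | curv i j m =>
        simp only [FlowTerm.weight] at hwt
        simp only [FlowTerm.bound]
        have h1 := curv_product_le hX0 hX00 hε0 hε1 hK hXl hwt
        have n1 := mul_nonneg (hX0 (l + 1)) (hX0 l)
        -- Curvature monomials carry two derivatives fewer, so one factor τ is left over; it pairs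
        -- with Λ and τΛ ≤ 1/2.
        have e : τ ^ (l + 1) * (Λ * (√(N i i) * √(N (j + 1) (j + 1)) * √(N m m) * √(N l l))) =
            (τ * Λ) * (X i * X (j + 1) * X m * X l) := by
          have : τ ^ (l + 1) = τ * (σ ^ i * σ ^ (j + 1) * σ ^ m * σ ^ l) := by
            rw [pow_succ', ← pow_add, ← pow_add, ← pow_add, ← hσ2, ← pow_mul]
            congr 2
            omega
          rw [this]; simp only [hX]; ring
        rw [e]
        have p0 : 0 ≤ X i * X (j + 1) * X m * X l :=
          mul_nonneg (mul_nonneg (mul_nonneg (hX0 _) (hX0 _)) (hX0 _)) (hX0 _)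
        have hK3 : 0 ≤ K ^ 3 := by positivity
        nlinarith [mul_nonneg hK3 n1, mul_nonneg hτ.le hΛ]
    have hsum : τ ^ (l + 1) * ((reaction l).map (FlowTerm.bound Λ N l)).sum ≤
        A * (X (l + 1) * X l + X l ^ 2 + ε ^ 2) := by
      rw [← List.sum_map_mul_left]
      refine (List.sum_le_card_nsmul _ (K ^ 3 * (X (l + 1) * X l + X l ^ 2 + ε ^ 2)) ?_).trans ?_
      · intro x hx
        obtain ⟨q, hq, rfl⟩ := List.mem_map.1 hx
        exact hterm q hq
      · rw [List.length_map, nsmul_eq_mul, hA, hn]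
        exact (mul_assoc _ _ _).ge
    have hS2 : τ ^ (l + 1) * S ≤ A * (X (l + 1) * X l + X l ^ 2 + ε ^ 2) :=
      le_trans (mul_le_mul_of_nonneg_left ((le_abs_self S).trans hS) (by positivity)) hsum
    obtain ⟨k, rfl⟩ : ∃ k, l = k + 1 := ⟨l - 1, by omega⟩
    rw [Nat.add_sub_cancel]
    refine le_of_mul_le_mul_left ?_ hτ
    have e1 : τ * (τ ^ (k + 1) * (-2 * N (k + 1 + 1) (k + 1 + 1) + 2 * S)) =
        -2 * X (k + 1 + 1) ^ 2 + 2 * (τ ^ (k + 1 + 1) * S) := by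
      rw [hXsq]; ring
    have e2 : τ * (-(τ ^ (k + 1) * N (k + 1 + 1) (k + 1 + 1)) +
        (A ^ 2 + 2 * A) * (τ ^ k * N (k + 1) (k + 1) + M)) =
        -X (k + 1 + 1) ^ 2 + (A ^ 2 + 2 * A) * (X (k + 1) ^ 2 + ε ^ 2) := by
      rw [hXsq, hXsq, hε2]; ring
    rw [e1, e2]
    -- Young's inequality 2A X_{l+1} X_l ≤ X_{l+1}² + A² X_l² uses up one of the two good terms and
    -- produces the A² in the constant.
    nlinarith [sq_nonneg (X (k + 1 + 1) - A * X (k + 1)), mul_nonneg (sq_nonneg A) (sq_nonneg ε)]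

end ReactionEstimate

/-! ### Curvature doubling and Bernstein estimates for the scalar system -/

/-- A scalar flow on an interval `[t₀, t₁]` of admissible length, with initial curvature bound
`k² ≤ K₀`. -/
structure EstimateSetting (Λ : ℝ) (J : Set ℝ) (G : ℕ → ℕ → ℝ → ℝ → ℝ) (v : ℝ → ℝ → ℝ)
    (t₀ t₁ K₀ : ℝ) : Prop where
  flow : IsScalarFlow Λ J G v
  pos : 0 < Λ
  ordConnected : J.OrdConnected
  left_mem : t₀ ∈ J
  right_mem : t₁ ∈ J
  nonneg : 0 ≤ K₀
  initial : ∀ u, G 1 1 u t₀ ≤ K₀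
  time_le : t₁ ≤ t₀ + 1 / (2 * Λ) * Real.log (1 + Λ / (4 * K₀ + Λ + 1))

/-- Since ∂_u = v ∂_s, the second u-derivative is v² ∂_s² plus a multiple of the first derivative,
which vanishes at the maximum. A combination of two orders is allowed because Bernstein's quantity
involves two. -/
theorem IsScalarFlow.second_derivative_nonpos {Λ : ℝ} {J : Set ℝ} {G : ℕ → ℕ → ℝ → ℝ → ℝ}
    {v : ℝ → ℝ → ℝ} (h : IsScalarFlow Λ J G v) {t : ℝ} (ht : t ∈ interior J) {u α β : ℝ} (l m : ℕ)
    (hmax : ∀ u', α * G l l u' t + β * G m m u' t ≤ α * G l l u t + β * G m m u t) :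
    α * (G (l + 2) l u t + G (l + 1) (l + 1) u t) +
      β * (G (m + 2) m u t + G (m + 1) (m + 1) u t) ≤ 0 := by
  have hd := fun i j ↦ h.hasDerivAt_fst i j t ht
  have h1 : ∀ x, HasDerivAt (fun x ↦ α * G l l x t + β * G m m x t)
      (v x t * (α * (G (l + 1) l x t + G l (l + 1) x t) +
        β * (G (m + 1) m x t + G m (m + 1) x t))) x := fun x ↦
    (((hd l l x).const_mul α).add ((hd m m x).const_mul β)).congr_deriv (by ring)
  have hv := (h.differentiableAt_speed t ht u).hasDerivAt
  have h2 := hv.mul ((((hd (l + 1) l u).add (hd l (l + 1) u)).const_mul α).add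
    (((hd (m + 1) m u).add (hd m (m + 1) u)).const_mul β))
  obtain ⟨e0, e1⟩ := deriv_eq_zero_and_deriv_nonpos_of_max h1 h2 hmax
  have hpos := h.speed_pos t ht u
  have e0' := (mul_eq_zero.1 e0).resolve_left hpos.ne'
  simp only [Pi.add_apply] at e1
  rw [e0', mul_zero, zero_add, h.symm l (l + 1 + 1), h.symm m (m + 1 + 1)] at e1
  have e2 : (2 * v u t ^ 2) * (α * (G (l + 2) l u t + G (l + 1) (l + 1) u t) +
      β * (G (m + 2) m u t + G (m + 1) (m + 1) u t)) ≤ 0 := by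
    refine le_trans (le_of_eq ?_) e1
    ring
  by_contra! hc
  have : 0 < (2 * v u t ^ 2) * (α * (G (l + 2) l u t + G (l + 1) (l + 1) u t) +
      β * (G (m + 2) m u t + G (m + 1) (m + 1) u t)) := by positivity
  linarith

/-- The solution of `y' = 2 y² + 2 Λ y` with initial value `K` at most doubles on the admissible
time interval. -/
theorem exists_barrier {Λ K t₀ t₁ : ℝ} (hΛ : 0 < Λ) (hK : 0 ≤ K)
    (ht : t₁ ≤ t₀ + 1 / (2 * Λ) * Real.log (1 + Λ / (4 * K + Λ + 1))) :
    ∃ y : ℝ → ℝ, y t₀ = K ∧ ∀ t ∈ Icc t₀ t₁,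
      HasDerivAt y (2 * y t ^ 2 + 2 * Λ * y t) t ∧ 0 ≤ y t ∧ y t ≤ 2 * K := by
  set D := 4 * K + Λ + 1 with hD
  have hD0 : 0 < D := by positivity
  -- The equation is of Bernoulli type: 1/y solves a linear equation, which yields this quotient.
  set den : ℝ → ℝ := fun t ↦ 1 - K / Λ * (Real.exp (2 * Λ * (t - t₀)) - 1) with hden
  refine ⟨fun t ↦ K * Real.exp (2 * Λ * (t - t₀)) / den t, by simp [hden], fun t htt ↦ ?_⟩
  have he0 := Real.exp_pos (2 * Λ * (t - t₀))
  have he : Real.exp (2 * Λ * (t - t₀)) ≤ 1 + Λ / D := by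
    have h1 : 2 * Λ * (t - t₀) ≤ Real.log (1 + Λ / D) := by
      have : t - t₀ ≤ 1 / (2 * Λ) * Real.log (1 + Λ / D) := by linarith [htt.2]
      calc 2 * Λ * (t - t₀) ≤ 2 * Λ * (1 / (2 * Λ) * Real.log (1 + Λ / D)) := by gcongr
        _ = Real.log (1 + Λ / D) := by field_simp
    calc Real.exp (2 * Λ * (t - t₀)) ≤ Real.exp (Real.log (1 + Λ / D)) := Real.exp_le_exp.2 h1
      _ = 1 + Λ / D := Real.exp_log (by positivity)
  have hden1 : 1 - K / D ≤ den t := by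
    have : K / Λ * (Real.exp (2 * Λ * (t - t₀)) - 1) ≤ K / Λ * (Λ / D) := by
      gcongr; linarith
    have e : K / Λ * (Λ / D) = K / D := by field_simp
    simp only [hden]; linarith
  have hKD : K / D ≤ 1 / 4 := by
    rw [div_le_iff₀ hD0]; linarith
  have hdenpos : 0 < den t := by linarith
  refine ⟨?_, by positivity, ?_⟩
  · have hE : HasDerivAt (fun s ↦ Real.exp (2 * Λ * (s - t₀)))
        (Real.exp (2 * Λ * (t - t₀)) * (2 * Λ)) t := by
      simpa using (((hasDerivAt_id t).sub_const t₀).const_mul (2 * Λ)).exp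
    have hdn : HasDerivAt den (-(K / Λ * (Real.exp (2 * Λ * (t - t₀)) * (2 * Λ)))) t := by
      simpa using ((hE.sub_const 1).const_mul (K / Λ)).const_sub 1
    refine ((hE.const_mul K).div hdn hdenpos.ne').congr_deriv ?_
    field_simp
    ring
  · rw [div_le_iff₀ hdenpos]
    have h1 : Real.exp (2 * Λ * (t - t₀)) ≤ 2 * den t := by
      -- The doubling condition 1 + Λ/D ≤ 2(1 - K/D) reduces to Λ + 2K ≤ D.
      have h2 : Λ / D + 2 * (K / D) ≤ 1 := by
        rw [← mul_div_assoc, ← add_div, div_le_one hD0]; linarith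
      linarith
    calc K * Real.exp (2 * Λ * (t - t₀)) ≤ K * (2 * den t) := by gcongr
      _ = 2 * K * den t := by ring

namespace EstimateSetting

variable {Λ : ℝ} {J : Set ℝ} {G : ℕ → ℕ → ℝ → ℝ → ℝ} {v : ℝ → ℝ → ℝ} {t₀ t₁ K₀ : ℝ}

theorem Icc_subset (h : EstimateSetting Λ J G v t₀ t₁ K₀) : Icc t₀ t₁ ⊆ J :=
  h.ordConnected.out h.left_mem h.right_mem

theorem Ioo_subset (h : EstimateSetting Λ J G v t₀ t₁ K₀) : Ioo t₀ t₁ ⊆ interior J :=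
  interior_maximal (Ioo_subset_Icc_self.trans h.Icc_subset) isOpen_Ioo

/-- From log(1 + x) ≤ x, the elapsed time is at most 1/(2(4K₀ + Λ + 1)). -/
theorem time_mul_le (h : EstimateSetting Λ J G v t₀ t₁ K₀) {t : ℝ} (ht : t ∈ Ioo t₀ t₁) :
    (t - t₀) * K₀ ≤ 1 / 8 ∧ (t - t₀) * Λ ≤ 1 / 2 := by
  have hΛ := h.pos
  have hK := h.nonneg
  have hD : 0 < 4 * K₀ + Λ + 1 := by positivity
  have h1 : Real.log (1 + Λ / (4 * K₀ + Λ + 1)) ≤ Λ / (4 * K₀ + Λ + 1) := by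
    have := Real.log_le_sub_one_of_pos (x := 1 + Λ / (4 * K₀ + Λ + 1)) (by positivity)
    linarith
  have h2 : t - t₀ ≤ 1 / (2 * (4 * K₀ + Λ + 1)) := by
    calc t - t₀ ≤ 1 / (2 * Λ) * Real.log (1 + Λ / (4 * K₀ + Λ + 1)) := by
          linarith [h.time_le, ht.2]
      _ ≤ 1 / (2 * Λ) * (Λ / (4 * K₀ + Λ + 1)) := by gcongr
      _ = 1 / (2 * (4 * K₀ + Λ + 1)) := by field_simp
  rw [le_div_iff₀ (by positivity)] at h2
  have hτ : 0 < t - t₀ := sub_pos.2 ht.1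
  have := mul_nonneg hτ.le hK
  have := mul_nonneg hτ.le hΛ.le
  constructor <;> nlinarith

/-- A qualitative bound from compactness. It only serves to linearise the comparison with the
barrier and does not enter the final constants. -/
theorem exists_bound (h : EstimateSetting Λ J G v t₀ t₁ K₀) :
    ∃ C, ∀ t ∈ Icc t₀ t₁, ∀ u, G 1 1 u t ≤ C := by
  have hc : ContinuousOn (fun p : ℝ × ℝ ↦ G 1 1 p.1 p.2)
      (Icc 0 (2 * Real.pi) ×ˢ Icc t₀ t₁) :=
    (h.flow.continuousOn 1 1).mono (prod_mono (subset_univ _) h.Icc_subset)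
  obtain ⟨C, hC⟩ := (isCompact_Icc.prod isCompact_Icc).bddAbove_image hc
  refine ⟨C, fun t ht u ↦ ?_⟩
  obtain ⟨u', hu', e⟩ := exists_mem_Icc_of_periodic (f := fun u ↦ G 1 1 u t)
    (h.flow.periodic 1 1 t (h.Icc_subset ht)) u
  exact e ▸ hC ⟨(u', t), ⟨hu', ht⟩, rfl⟩

theorem curvature_le (h : EstimateSetting Λ J G v t₀ t₁ K₀) {t : ℝ} (ht : t ∈ Ioo t₀ t₁) (u : ℝ) :
    G 1 1 u t ≤ 2 * K₀ := by
  obtain ⟨C, hC⟩ := h.exists_bound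
  obtain ⟨y, hy0, hy⟩ := exists_barrier h.pos h.nonneg h.time_le
  have hsub : Icc t₀ t ⊆ Icc t₀ t₁ := Icc_subset_Icc_right ht.2.le
  have hΛ := h.pos
  have key : ∀ s ∈ Icc t₀ t, ∀ u, G 1 1 u s - y s ≤ 0 := by
    -- The difference of the quadratic right-hand sides is (2(k² + y) + 2Λ)(k² - y), with k² ≤ C and
    -- y ≤ 2K₀.
    refine le_zero_of_max_principle (C := 2 * (C + 2 * K₀) + 2 * Λ) ?_ ?_ ?_ ?_
    · intro s hs u
      rw [h.flow.periodic 1 1 s (h.Icc_subset (hsub hs))]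
    · refine ((h.flow.continuousOn 1 1).mono
        (prod_mono subset_rfl (hsub.trans h.Icc_subset))).sub ?_
      have hyc : ContinuousOn y (Icc t₀ t) := fun s hs ↦
        (hy s (hsub hs)).1.continuousAt.continuousWithinAt
      exact hyc.comp continuousOn_snd fun p hp ↦ hp.2
    · intro u
      rw [hy0]; linarith [h.initial u]
    · intro s hs u hpos hmax
      have hsI : s ∈ interior J := h.Ioo_subset ⟨hs.1, hs.2.trans_lt ht.2⟩
      have hsc := hsub (Ioc_subset_Icc_self hs)
      obtain ⟨S, hS, hd⟩ := h.flow.hasDerivAt_snd 1 s hsI u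
      obtain ⟨hyd, hyn, hyle⟩ := hy s hsc
      refine ⟨_, hd.sub hyd, ?_⟩
      have hsp := h.flow.second_derivative_nonpos hsI (α := 1) (β := 0) (u := u) 1 0
        fun u' ↦ by linarith [hmax u']
      rw [sum_bound_reaction_one (fun l ↦ h.flow.nonneg l u s) (h.flow.zero_zero s hsI u)
        (h.flow.zero_one s hsI u)] at hS
      have hS' := (abs_le.1 hS).2
      have hCS := h.flow.abs_le 0 2 u s
      rw [h.flow.zero_zero s hsI u, h.flow.zero_two s hsI u, abs_neg,
        abs_of_nonneg (h.flow.nonneg 1 u s), Real.sqrt_one, one_mul] at hCS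
      have hF2 : G 1 1 u s ^ 2 ≤ G 2 2 u s := by
        calc G 1 1 u s ^ 2 ≤ √(G 2 2 u s) ^ 2 := by
              have := h.flow.nonneg 1 u s
              gcongr
          _ = G 2 2 u s := Real.sq_sqrt (h.flow.nonneg 2 u s)
      norm_num at hsp hS' ⊢
      have hfac : 2 * (G 1 1 u s + y s) + 2 * Λ ≤ 2 * (C + 2 * K₀) + 2 * Λ := by
        linarith [hC s hsc u]
      have := mul_le_mul_of_nonneg_right hfac hpos.le
      nlinarith
  have h1 := key t ⟨ht.1.le, le_rfl⟩ u
  have h2 := (hy t ⟨ht.1.le, ht.2.le⟩).2.2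
  linarith

end EstimateSetting

/-- The interior derivative estimates, with constants depending only on the order. -/
theorem exists_derivative_bound (l : ℕ) : 1 ≤ l → ∃ K : ℝ, 1 ≤ K ∧
    ∀ (Λ : ℝ) (J : Set ℝ) (G : ℕ → ℕ → ℝ → ℝ → ℝ) (v : ℝ → ℝ → ℝ) (t₀ t₁ K₀ : ℝ),
      EstimateSetting Λ J G v t₀ t₁ K₀ → ∀ t ∈ Ioo t₀ t₁, ∀ u, ∀ j, 1 ≤ j → j ≤ l →
        (t - t₀) ^ (j - 1) * G j j u t ≤ K * K₀ := by
  intro hl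
  induction l, hl using Nat.le_induction with
  | base =>
    refine ⟨2, by norm_num, fun Λ J G v t₀ t₁ K₀ h t ht u j hj1 hj2 ↦ ?_⟩
    obtain rfl : j = 1 := le_antisymm hj2 hj1
    simpa using h.curvature_le ht u
  | succ l hl ih =>
    obtain ⟨K, hK, hbound⟩ := ih
    obtain ⟨B₀, hB₀, hest₀⟩ := reaction_estimate hl hK
    obtain ⟨B₁, hB₁, hest₁⟩ := reaction_estimate (l := l + 1) (by omega) hK
    -- B P must cover (l + 1) P, from differentiating τ^{l+1}, and B₁ P, from the reaction at order
    -- l + 1, where P = τ^l|A_{l+1}|².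
    set B : ℝ := B₁ + (l + 1) with hB
    have hBpos : 0 ≤ B := by positivity
    -- C collects what remains once the P terms cancel and τ^{l-1}|A_l|² is bounded by K K₀.
    set C : ℝ := B₁ + B * (l * K + B₀ * (K + 1)) with hC
    have hCpos : 0 ≤ C := by positivity
    refine ⟨max K C, le_max_of_le_left hK, fun Λ J G v t₀ t₁ K₀ h t ht u j hj1 hj2 ↦ ?_⟩
    have hK₀ := h.nonneg
    rcases hj2.lt_or_eq with hlt | rfl
    · refine (hbound Λ J G v t₀ t₁ K₀ h t ht u j hj1 (by omega)).trans ?_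
      gcongr
      exact le_max_left _ _
    have hsub : Icc t₀ t ⊆ J := (Icc_subset_Icc_right ht.2.le).trans h.Icc_subset
    have key : ∀ s ∈ Icc t₀ t, ∀ u, ((s - t₀) ^ (l + 1) * G (l + 1) (l + 1) u s +
        B * (s - t₀) ^ l * G l l u s) - C * K₀ * (s - t₀) ≤ 0 := by
      refine le_zero_of_max_principle (C := 0) ?_ ?_ ?_ ?_
      · intro s hs u
        rw [h.flow.periodic _ _ s (hsub hs), h.flow.periodic _ _ s (hsub hs)]
      · have hc := fun i ↦ (h.flow.continuousOn i i).mono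
          (prod_mono (subset_refl (univ : Set ℝ)) hsub)
        refine ContinuousOn.sub (ContinuousOn.add (ContinuousOn.mul (by fun_prop) (hc _))
          (ContinuousOn.mul (by fun_prop) (hc _))) (by fun_prop)
      -- Both powers of τ vanish at t₀ as l ≥ 1, so no initial bound on higher derivatives is
      -- required.
      · intro u
        simp [show l ≠ 0 by omega]
      · intro s hs u _ hmax
        have hsO : s ∈ Ioo t₀ t₁ := ⟨hs.1, hs.2.trans_lt ht.2⟩
        have hsI : s ∈ interior J := h.Ioo_subset hsO
        obtain ⟨S₁, hS₁, hd₁⟩ := h.flow.hasDerivAt_snd (l + 1) s hsI u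
        obtain ⟨S₀, hS₀, hd₀⟩ := h.flow.hasDerivAt_snd l s hsI u
        have hτ : 0 < s - t₀ := sub_pos.2 hs.1
        have hpow : ∀ n : ℕ, HasDerivAt (fun s ↦ (s - t₀) ^ n) (n * (s - t₀) ^ (n - 1)) s :=
          fun n ↦ by simpa using ((hasDerivAt_id s).sub_const t₀).fun_pow n
        have hlin : HasDerivAt (fun s ↦ C * K₀ * (s - t₀)) (C * K₀) s := by
          simpa using ((hasDerivAt_id s).sub_const t₀).const_mul (C * K₀)
        refine ⟨_, (((hpow (l + 1)).mul hd₁).add (((hpow l).const_mul B).mul hd₀)).sub hlin, ?_⟩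
        have hsp := h.flow.second_derivative_nonpos hsI (α := (s - t₀) ^ (l + 1))
          (β := B * (s - t₀) ^ l) (u := u) (l + 1) l fun u' ↦ by linarith [hmax u']
        obtain ⟨hm1, hm2⟩ := h.time_mul_le hsO
        have e₁ := hest₁ Λ K₀ (s - t₀) (fun i j ↦ G i j u s) h.pos.le hτ hK₀ hm1 hm2
          (fun l ↦ h.flow.nonneg l u s) (fun i j ↦ h.flow.abs_le i j u s)
          (h.flow.zero_zero s hsI u) (h.flow.zero_one s hsI u) (h.flow.zero_two s hsI u)
          (h.curvature_le hsO u)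
          (fun j h1 h2 ↦ hbound Λ J G v t₀ t₁ K₀ h s hsO u j h1 (by omega)) S₁ hS₁
        have e₀ := hest₀ Λ K₀ (s - t₀) (fun i j ↦ G i j u s) h.pos.le hτ hK₀ hm1 hm2
          (fun l ↦ h.flow.nonneg l u s) (fun i j ↦ h.flow.abs_le i j u s)
          (h.flow.zero_zero s hsI u) (h.flow.zero_one s hsI u) (h.flow.zero_two s hsI u)
          (h.curvature_le hsO u)
          (fun j h1 h2 ↦ hbound Λ J G v t₀ t₁ K₀ h s hsO u j h1 (by omega)) S₀ hS₀
        have eF := hbound Λ J G v t₀ t₁ K₀ h s hsO u l hl le_rfl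
        have hnn : 0 ≤ (s - t₀) ^ (l + 1) * G (l + 2) (l + 2) u s :=
          mul_nonneg (by positivity) (h.flow.nonneg _ u s)
        simp only [Nat.add_sub_cancel, zero_mul] at e₁ ⊢
        push_cast
        set P := (s - t₀) ^ l * G (l + 1) (l + 1) u s with hP
        set Q := (s - t₀) ^ (l - 1) * G l l u s with hQ
        have e₀' := mul_le_mul_of_nonneg_left e₀ hBpos
        have eF' := mul_le_mul_of_nonneg_left eF
          (show 0 ≤ B * (l + B₀) by positivity)
        have id1 : ((l : ℝ) + 1) * (s - t₀) ^ l * G (l + 1) (l + 1) u s +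
            (s - t₀) ^ (l + 1) * (2 * G (l + 1 + 2) (l + 1) u s + 2 * S₁) +
            (B * (l * (s - t₀) ^ (l - 1)) * G l l u s +
              B * (s - t₀) ^ l * (2 * G (l + 2) l u s + 2 * S₀)) - C * K₀ =
            (l + 1) * P + B * l * Q +
            2 * ((s - t₀) ^ (l + 1) * (G (l + 1 + 2) (l + 1) u s + G (l + 1 + 1) (l + 1 + 1) u s) +
              B * (s - t₀) ^ l * (G (l + 2) l u s + G (l + 1) (l + 1) u s)) +
            (s - t₀) ^ (l + 1) * (-2 * G (l + 1 + 1) (l + 1 + 1) u s + 2 * S₁) +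
            B * ((s - t₀) ^ l * (-2 * G (l + 1) (l + 1) u s + 2 * S₀)) - C * K₀ := by
          rw [hP, hQ]; ring
        have id2 : C * K₀ = B₁ * K₀ + B * (l + B₀) * (K * K₀) + B * B₀ * K₀ := by rw [hC]; ring
        have id3 : B * P = B₁ * P + (l + 1) * P := by rw [hB]; ring
        rw [id1]
        nlinarith
    have hfin := key t ⟨ht.1.le, le_rfl⟩ u
    have hτ : 0 < t - t₀ := sub_pos.2 ht.1
    have hn : 0 ≤ B * (t - t₀) ^ l * G l l u t :=
      mul_nonneg (by positivity) (h.flow.nonneg _ _ _)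
    rw [Nat.add_sub_cancel]
    refine le_trans ?_ (mul_le_mul_of_nonneg_right (le_max_right K C) hK₀)
    refine le_of_mul_le_mul_left ?_ hτ
    calc (t - t₀) * ((t - t₀) ^ l * G (l + 1) (l + 1) u t)
        = (t - t₀) ^ (l + 1) * G (l + 1) (l + 1) u t := by ring
      _ ≤ C * K₀ * (t - t₀) := by linarith
      _ = (t - t₀) * (C * K₀) := by ring

/-! ### Levi-Civita calculus for a metric on an open subset of a vector space -/

section MetricField

variable {E : Type*} [NormedAddCommGroup E] [NormedSpace ℝ E]

/-- Christoffel symbols of the first kind of a field `g` of bilinear forms on a vector space. -/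
def gLower (g : E → E →L[ℝ] E →L[ℝ] ℝ) (y v w : E) : E →L[ℝ] ℝ :=
  (1 / 2 : ℝ) • (fderiv ℝ g y v w + fderiv ℝ g y w v - ((fderiv ℝ g y).flip v).flip w)

/-- Christoffel symbols of the second kind of a field of bilinear forms on a vector space. -/
def gChristoffel (g : E → E →L[ℝ] E →L[ℝ] ℝ) (y v w : E) : E :=
  (g y).inverse (gLower g y v w)

/-- The curvature operator of a field of bilinear forms on a vector space. -/
def gCurvature (g : E → E →L[ℝ] E →L[ℝ] ℝ) (y v w z : E) : E :=
  fderiv ℝ (fun y' ↦ gChristoffel g y' v z) y w - fderiv ℝ (fun y' ↦ gChristoffel g y' w z) y v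
    + gChristoffel g y w (gChristoffel g y v z) - gChristoffel g y v (gChristoffel g y w z)

/-- The covariant derivative of the curvature of a field of bilinear forms on a vector space. -/
def gCovDerivCurvature (g : E → E →L[ℝ] E →L[ℝ] ℝ) (y a v w z : E) : E :=
  fderiv ℝ (fun y' ↦ gCurvature g y' v w z) y a + gChristoffel g y a (gCurvature g y v w z)
    - gCurvature g y (gChristoffel g y a v) w z - gCurvature g y v (gChristoffel g y a w) z
    - gCurvature g y v w (gChristoffel g y a z)

/-- `g` is a smooth Riemannian metric on the open set `Ω` of a vector space. -/
structure IsMetricOn (g : E → E →L[ℝ] E →L[ℝ] ℝ) (Ω : Set E) : Prop where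
  isOpen : IsOpen Ω
  contDiffOn : ContDiffOn ℝ ∞ g Ω
  symm : ∀ y ∈ Ω, ∀ v w, g y v w = g y w v
  pos : ∀ y ∈ Ω, ∀ v, v ≠ 0 → 0 < g y v v

/-- The Christoffel symbols as a bilinear map. -/
def christoffelB (g : E → E →L[ℝ] E →L[ℝ] ℝ) (y : E) : E →L[ℝ] E →L[ℝ] E :=
  ContinuousLinearMap.compL ℝ E (E →L[ℝ] ℝ) E (g y).inverse ∘L
    ((1 / 2 : ℝ) • (fderiv ℝ g y + (fderiv ℝ g y).flip -
      ((ContinuousLinearMap.flipₗᵢ ℝ E E ℝ).toContinuousLinearEquiv.toContinuousLinearMap ∘L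
        (fderiv ℝ g y).flip)))

theorem christoffelB_apply (g : E → E →L[ℝ] E →L[ℝ] ℝ) (y v w : E) :
    christoffelB g y v w = gChristoffel g y v w := by
  simp [christoffelB, gChristoffel, gLower]

/-- The curvature as a trilinear map. -/
def curvatureB (g : E → E →L[ℝ] E →L[ℝ] ℝ) (y : E) : E →L[ℝ] E →L[ℝ] E →L[ℝ] E :=
  (fderiv ℝ (christoffelB g) y).flip - fderiv ℝ (christoffelB g) y
    + ((ContinuousLinearMap.compL ℝ E E E).bilinearComp (christoffelB g y)
        (christoffelB g y)).flip
    - (ContinuousLinearMap.compL ℝ E E E).bilinearComp (christoffelB g y) (christoffelB g y)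

namespace IsMetricOn

variable {g : E → E →L[ℝ] E →L[ℝ] ℝ} {Ω : Set E}

theorem eq_of_forall (hg : IsMetricOn g Ω) {y : E} (hy : y ∈ Ω) {v w : E}
    (h : ∀ z, g y v z = g y w z) : v = w := by
  by_contra hne
  have := hg.pos y hy (v - w) (sub_ne_zero.2 hne)
  simp [h] at this

theorem contDiffAt (hg : IsMetricOn g Ω) {y : E} (hy : y ∈ Ω) : ContDiffAt ℝ ∞ g y :=
  hg.contDiffOn.contDiffAt (hg.isOpen.mem_nhds hy)

theorem differentiableAt (hg : IsMetricOn g Ω) {y : E} (hy : y ∈ Ω) : DifferentiableAt ℝ g y :=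
  (hg.contDiffAt hy).differentiableAt (by simp)

theorem contDiffOn_fderiv (hg : IsMetricOn g Ω) : ContDiffOn ℝ ∞ (fderiv ℝ g) Ω :=
  hg.contDiffOn.fderiv_of_isOpen hg.isOpen (by simp)

theorem fderiv_symm (hg : IsMetricOn g Ω) {y : E} (hy : y ∈ Ω) (a v w : E) :
    fderiv ℝ g y a v w = fderiv ℝ g y a w v := by
  have h1 : ∀ v w, HasFDerivAt (fun y ↦ g y v w) _ y := fun v w ↦
    ((hg.differentiableAt hy).hasFDerivAt.clm_apply (hasFDerivAt_const v y)).clm_apply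
      (hasFDerivAt_const w y)
  have h3 : (fun y ↦ g y v w) =ᶠ[nhds y] fun y ↦ g y w v := by
    filter_upwards [hg.isOpen.mem_nhds hy] with y hy using hg.symm y hy v w
  have := congrArg (fun f ↦ f a) ((h1 v w).unique ((h1 w v).congr_of_eventuallyEq h3))
  simpa using this

variable [FiniteDimensional ℝ E]

/-- Positivity gives injectivity into the dual; equality of finite dimensions does the rest. -/
theorem isInvertible (hg : IsMetricOn g Ω) {y : E} (hy : y ∈ Ω) : (g y).IsInvertible := by
  have hinj : Function.Injective (g y) := fun v w h ↦ hg.eq_of_forall hy fun z ↦ by rw [h]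
  have hdim : Module.finrank ℝ E = Module.finrank ℝ (E →L[ℝ] ℝ) := by
    rw [← LinearMap.toContinuousLinearMap.finrank_eq]
    exact (Subspace.dual_finrank_eq (K := ℝ) (V := E)).symm
  let e := (LinearEquiv.ofInjectiveOfFinrankEq (g y).toLinearMap hinj hdim).toContinuousLinearEquiv
  exact ⟨e, by ext v w; rfl⟩

theorem apply_gChristoffel (hg : IsMetricOn g Ω) {y : E} (hy : y ∈ Ω) (v w z : E) :
    g y (gChristoffel g y v w) z =
      1 / 2 * (fderiv ℝ g y v w z + fderiv ℝ g y w v z - fderiv ℝ g y z v w) := by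
  have h : g y ((g y).inverse (gLower g y v w)) = gLower g y v w := by
    obtain ⟨e, he⟩ := hg.isInvertible hy
    rw [← he]; simp
  rw [gChristoffel, h]
  simp [gLower]

theorem gChristoffel_comm (hg : IsMetricOn g Ω) {y : E} (hy : y ∈ Ω) (v w : E) :
    gChristoffel g y v w = gChristoffel g y w v := by
  refine hg.eq_of_forall hy fun z ↦ ?_
  rw [hg.apply_gChristoffel hy, hg.apply_gChristoffel hy, hg.fderiv_symm hy z v w]
  ring

/-- Metric compatibility ∇g = 0, obtained by adding two Koszul formulas. -/
theorem fderiv_apply (hg : IsMetricOn g Ω) {y : E} (hy : y ∈ Ω) (a v w : E) :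
    fderiv ℝ g y a v w = g y (gChristoffel g y a v) w + g y v (gChristoffel g y a w) := by
  rw [hg.symm y hy v, hg.apply_gChristoffel hy, hg.apply_gChristoffel hy, hg.fderiv_symm hy v a w,
    hg.fderiv_symm hy w a v, hg.fderiv_symm hy a v w]
  ring

theorem contDiffOn_christoffelB (hg : IsMetricOn g Ω) : ContDiffOn ℝ ∞ (christoffelB g) Ω := by
  refine contDiffOn_clm_apply.2 fun v ↦ contDiffOn_clm_apply.2 fun w ↦ ?_
  simp only [christoffelB_apply, gChristoffel]
  have h1 : ContDiffOn ℝ ∞ (fun y ↦ (g y).inverse) Ω := fun y hy ↦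
    ((hg.isInvertible hy).contDiffAt_map_inverse.comp y (hg.contDiffAt hy)).contDiffWithinAt
  have h2 : ContDiffOn ℝ ∞ (fun y ↦ gLower g y v w) Ω := by
    refine contDiffOn_clm_apply.2 fun z ↦ ?_
    have hf := hg.contDiffOn_fderiv
    have : ∀ a b c : E, ContDiffOn ℝ ∞ (fun y ↦ fderiv ℝ g y a b c) Ω := fun a b c ↦
      ((hf.clm_apply contDiffOn_const).clm_apply contDiffOn_const).clm_apply contDiffOn_const
    have := ((this v w z).add (this w v z)).sub (this z v w)
    exact (contDiffOn_const (c := (1 / 2 : ℝ))).mul this |>.congr fun y _ ↦ by simp [gLower]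
  exact h1.clm_apply h2

theorem differentiableAt_christoffelB (hg : IsMetricOn g Ω) {y : E} (hy : y ∈ Ω) :
    DifferentiableAt ℝ (christoffelB g) y :=
  (hg.contDiffOn_christoffelB.contDiffAt (hg.isOpen.mem_nhds hy)).differentiableAt (by simp)

theorem fderiv_gChristoffel (hg : IsMetricOn g Ω) {y : E} (hy : y ∈ Ω) (v z w : E) :
    fderiv ℝ (fun y' ↦ gChristoffel g y' v z) y w = fderiv ℝ (christoffelB g) y w v z := by
  have := (((hg.differentiableAt_christoffelB hy).hasFDerivAt.clm_apply
    (hasFDerivAt_const v y)).clm_apply (hasFDerivAt_const z y)).fderiv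
  simp only [christoffelB_apply] at this
  rw [this]; simp

/-- The trilinear form is what can be differentiated along a map. On Ω the bilinear Christoffel map
is differentiable, so freezing its arguments commutes with differentiation. -/
theorem curvatureB_apply (hg : IsMetricOn g Ω) {y : E} (hy : y ∈ Ω) (v w z : E) :
    curvatureB g y v w z = gCurvature g y v w z := by
  rw [gCurvature, hg.fderiv_gChristoffel hy, hg.fderiv_gChristoffel hy]
  simp [curvatureB, christoffelB_apply]

theorem contDiffOn_curvatureB (hg : IsMetricOn g Ω) : ContDiffOn ℝ ∞ (curvatureB g) Ω := by
  refine contDiffOn_clm_apply.2 fun v ↦ contDiffOn_clm_apply.2 fun w ↦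
    contDiffOn_clm_apply.2 fun z ↦ ?_
  have hΓ := hg.contDiffOn_christoffelB
  have hf : ContDiffOn ℝ ∞ (fderiv ℝ (christoffelB g)) Ω :=
    hΓ.fderiv_of_isOpen hg.isOpen (by simp)
  have h1 : ∀ a b c : E, ContDiffOn ℝ ∞ (fun y ↦ fderiv ℝ (christoffelB g) y a b c) Ω :=
    fun a b c ↦
      ((hf.clm_apply contDiffOn_const).clm_apply contDiffOn_const).clm_apply contDiffOn_const
  have h2 : ∀ a b c : E,
      ContDiffOn ℝ ∞ (fun y ↦ christoffelB g y a (christoffelB g y b c)) Ω := fun a b c ↦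
    (hΓ.clm_apply contDiffOn_const).clm_apply
      ((hΓ.clm_apply contDiffOn_const).clm_apply contDiffOn_const)
  refine (((h1 w v z).sub (h1 v w z)).add (h2 w v z)).sub (h2 v w z) |>.congr fun y _ ↦ ?_
  simp [curvatureB]

theorem differentiableAt_curvatureB (hg : IsMetricOn g Ω) {y : E} (hy : y ∈ Ω) :
    DifferentiableAt ℝ (curvatureB g) y :=
  (hg.contDiffOn_curvatureB.contDiffAt (hg.isOpen.mem_nhds hy)).differentiableAt (by simp)

theorem fderiv_gCurvature (hg : IsMetricOn g Ω) {y : E} (hy : y ∈ Ω) (v w z a : E) :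
    fderiv ℝ (fun y' ↦ gCurvature g y' v w z) y a = fderiv ℝ (curvatureB g) y a v w z := by
  have h := ((((hg.differentiableAt_curvatureB hy).hasFDerivAt.clm_apply
    (hasFDerivAt_const v y)).clm_apply (hasFDerivAt_const w y)).clm_apply (hasFDerivAt_const z y))
  have heq : (fun y' ↦ gCurvature g y' v w z) =ᶠ[nhds y] fun y' ↦ curvatureB g y' v w z := by
    filter_upwards [hg.isOpen.mem_nhds hy] with y' hy' using (hg.curvatureB_apply hy' v w z).symm
  rw [(h.congr_of_eventuallyEq heq).fderiv]; simp

/-- The transformation law of the Christoffel symbols under a change of coordinates `θ`. -/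
theorem gChristoffel_transform (hg : IsMetricOn g Ω) {g' : E → E →L[ℝ] E →L[ℝ] ℝ} {Ω' : Set E}
    (hg' : IsMetricOn g' Ω') {θ : E → E} {y : E} (hy : y ∈ Ω) (hθy : θ y ∈ Ω')
    (hθ : ContDiffAt ℝ ∞ θ y) (hsurj : Function.Surjective (fderiv ℝ θ y))
    (h : ∀ᶠ z in nhds y, ∀ v w, g z v w = g' (θ z) (fderiv ℝ θ z v) (fderiv ℝ θ z w)) (v w : E) :
    fderiv ℝ θ y (gChristoffel g y v w) =
      fderiv ℝ (fderiv ℝ θ) y v w +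
        gChristoffel g' (θ y) (fderiv ℝ θ y v) (fderiv ℝ θ y w) := by
  have hsymm : ∀ a b, fderiv ℝ (fderiv ℝ θ) y a b = fderiv ℝ (fderiv ℝ θ) y b a := fun a b ↦
    (hθ.isSymmSndFDerivAt (by simp; norm_cast)) a b
  have hθ1 : HasFDerivAt θ (fderiv ℝ θ y) y := (hθ.differentiableAt (by simp)).hasFDerivAt
  have hθ2 : HasFDerivAt (fderiv ℝ θ) (fderiv ℝ (fderiv ℝ θ) y) y :=
    ((hθ.fderiv_right (m := 1) (by norm_cast)).differentiableAt (by simp)).hasFDerivAt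
  have hpt := h.self_of_nhds
  have key : ∀ a b c, fderiv ℝ g y a b c =
      fderiv ℝ g' (θ y) (fderiv ℝ θ y a) (fderiv ℝ θ y b) (fderiv ℝ θ y c)
      + g' (θ y) (fderiv ℝ (fderiv ℝ θ) y a b) (fderiv ℝ θ y c)
      + g' (θ y) (fderiv ℝ θ y b) (fderiv ℝ (fderiv ℝ θ) y a c) := by
    intro a b c
    have h1 : HasFDerivAt (fun y ↦ g y b c) _ y :=
      ((hg.differentiableAt hy).hasFDerivAt.clm_apply (hasFDerivAt_const b y)).clm_apply
        (hasFDerivAt_const c y)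
    have h2 : HasFDerivAt (fun z ↦ g' (θ z) (fderiv ℝ θ z b) (fderiv ℝ θ z c)) _ y :=
      (((hg'.differentiableAt hθy).hasFDerivAt.comp y hθ1).clm_apply
        (hθ2.clm_apply (hasFDerivAt_const b y))).clm_apply
        (hθ2.clm_apply (hasFDerivAt_const c y))
    have h3 := h1.unique (h2.congr_of_eventuallyEq (h.mono fun z hz ↦ hz b c))
    have := congrArg (fun f ↦ f a) h3
    simp at this
    rw [this]; ring
  -- Surjectivity reduces to testing against images of vectors z. In the Koszul combination of the
  -- three derivatives of the pulled back metric, symmetry of the Hessian of θ leaves a single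
  -- Hessian term.
  refine hg'.eq_of_forall hθy fun z' ↦ ?_
  obtain ⟨z, rfl⟩ := hsurj z'
  rw [← hpt, hg.apply_gChristoffel hy, map_add, add_apply,
    hg'.apply_gChristoffel hθy, key, key, key, hsymm w v, hsymm z v, hsymm z w,
    hg'.symm _ hθy (fderiv ℝ θ y v) (fderiv ℝ (fderiv ℝ θ) y w z),
    hg'.symm _ hθy (fderiv ℝ θ y w) (fderiv ℝ (fderiv ℝ θ) y v z)]
  ring_nf

end IsMetricOn

end MetricField

/-! ### Covariant derivatives of vector fields along maps -/

section AlongMaps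

variable {E : Type*} [NormedAddCommGroup E] [NormedSpace ℝ E]
  {P : Type*} [NormedAddCommGroup P] [NormedSpace ℝ P]

/-- The covariant derivative, in direction `e`, of a vector field `V` along a map `c`. -/
def covD (g : E → E →L[ℝ] E →L[ℝ] ℝ) (c : P → E) (e : P) (V : P → E) (p : P) : E :=
  fderiv ℝ V p e + gChristoffel g (c p) (fderiv ℝ c p e) (V p)

variable {g : E → E →L[ℝ] E →L[ℝ] ℝ} {Ω : Set E} {c : P → E} {V W : P → E} {p : P}

theorem covD_congr {U : Set P} (hU : IsOpen U) (hp : p ∈ U) (h : EqOn V W U) (e : P) :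
    covD g c e V p = covD g c e W p := by
  have : V =ᶠ[nhds p] W := Filter.eventuallyEq_of_mem (hU.mem_nhds hp) h
  rw [covD, covD, this.fderiv_eq, h hp]

theorem covD_add (hV : DifferentiableAt ℝ V p) (hW : DifferentiableAt ℝ W p) (e : P) :
    covD g c e (fun q ↦ V q + W q) p = covD g c e V p + covD g c e W p := by
  simp only [covD, fderiv_fun_add hV hW, ← christoffelB_apply, map_add, add_apply]
  abel

theorem covD_smul {f : P → ℝ} (hf : DifferentiableAt ℝ f p) (hV : DifferentiableAt ℝ V p) (e : P) :
    covD g c e (fun q ↦ f q • V q) p = fderiv ℝ f p e • V p + f p • covD g c e V p := by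
  simp only [covD, fderiv_fun_smul hf hV, ← christoffelB_apply, map_smul, add_apply,
    smul_apply, ContinuousLinearMap.smulRight_apply, smul_add]
  abel

namespace IsMetricOn

variable [FiniteDimensional ℝ E]

theorem fderiv_comp (hg : IsMetricOn g Ω) (hp : c p ∈ Ω) (hc : DifferentiableAt ℝ c p)
    (hV : DifferentiableAt ℝ V p) (hW : DifferentiableAt ℝ W p) :
    DifferentiableAt ℝ (fun q ↦ g (c q) (V q) (W q)) p ∧ ∀ e,
    fderiv ℝ (fun q ↦ g (c q) (V q) (W q)) p e =
      g (c p) (covD g c e V p) (W p) + g (c p) (V p) (covD g c e W p) := by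
  have h : HasFDerivAt (fun q ↦ g (c q) (V q) (W q)) _ p :=
    (((hg.differentiableAt hp).hasFDerivAt.comp p hc.hasFDerivAt).clm_apply
      hV.hasFDerivAt).clm_apply hW.hasFDerivAt
  refine ⟨h.differentiableAt, fun e ↦ ?_⟩
  rw [h.fderiv]
  simp [covD, hg.fderiv_apply hp]
  ring

/-- Absence of torsion: the second derivative of c and the Christoffel symbols are both symmetric.
-/
theorem covD_fderiv_comm (hg : IsMetricOn g Ω) (hp : c p ∈ Ω) (hc : ContDiffAt ℝ ∞ c p) (e f : P) :
    covD g c e (fun q ↦ fderiv ℝ c q f) p = covD g c f (fun q ↦ fderiv ℝ c q e) p := by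
  have h2 : HasFDerivAt (fderiv ℝ c) (fderiv ℝ (fderiv ℝ c) p) p :=
    ((hc.fderiv_right (m := 1) (by norm_cast)).differentiableAt (by simp)).hasFDerivAt
  have hd : ∀ a b, fderiv ℝ (fun q ↦ fderiv ℝ c q a) p b = fderiv ℝ (fderiv ℝ c) p b a := by
    intro a b
    rw [(h2.clm_apply (hasFDerivAt_const a p)).fderiv]; simp
  rw [covD, covD, hd, hd, (hc.isSymmSndFDerivAt (by simp; norm_cast)) e f,
    hg.gChristoffel_comm hp]

/-- The Ricci identity: second derivatives of c and V cancel by symmetry, and the derivatives and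
products of Christoffel symbols assemble into the curvature. -/
theorem covD_covD (hg : IsMetricOn g Ω) (hp : c p ∈ Ω) (hc : ContDiffAt ℝ ∞ c p)
    (hV : ContDiffAt ℝ ∞ V p) (e f : P) :
    covD g c e (covD g c f V) p =
      covD g c f (covD g c e V) p +
        gCurvature g (c p) (fderiv ℝ c p f) (fderiv ℝ c p e) (V p) := by
  have hd : ∀ {X : P → E}, ContDiffAt ℝ ∞ X p →
      HasFDerivAt (fderiv ℝ X) (fderiv ℝ (fderiv ℝ X) p) p := fun hX ↦
    ((hX.fderiv_right (m := 1) (by norm_cast)).differentiableAt (by simp)).hasFDerivAt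
  have hc1 := (hc.differentiableAt (by simp)).hasFDerivAt
  have hV1 := (hV.differentiableAt (by simp)).hasFDerivAt
  have key : ∀ e f, fderiv ℝ (covD g c f V) p e = fderiv ℝ (fderiv ℝ V) p e f
      + fderiv ℝ (christoffelB g) (c p) (fderiv ℝ c p e) (fderiv ℝ c p f) (V p)
      + christoffelB g (c p) (fderiv ℝ (fderiv ℝ c) p e f) (V p)
      + christoffelB g (c p) (fderiv ℝ c p f) (fderiv ℝ V p e) := by
    intro e f
    have h : HasFDerivAt (fun q ↦ fderiv ℝ V q f +
        christoffelB g (c q) (fderiv ℝ c q f) (V q)) _ p :=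
      ((hd hV).clm_apply (hasFDerivAt_const f p)).add
        ((((hg.differentiableAt_christoffelB hp).hasFDerivAt.comp p hc1).clm_apply
          ((hd hc).clm_apply (hasFDerivAt_const f p))).clm_apply hV1)
    have h' : covD g c f V = fun q ↦ fderiv ℝ V q f +
        christoffelB g (c q) (fderiv ℝ c q f) (V q) := by
      funext q; simp [covD, christoffelB_apply]
    rw [h', h.fderiv]
    simp
    abel
  change fderiv ℝ (covD g c f V) p e + gChristoffel g (c p) (fderiv ℝ c p e) (covD g c f V p) =
    fderiv ℝ (covD g c e V) p f + gChristoffel g (c p) (fderiv ℝ c p f) (covD g c e V p) + _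
  rw [← hg.curvatureB_apply hp, key, key,
    (hc.isSymmSndFDerivAt (by simp; norm_cast)) e f,
    (hV.isSymmSndFDerivAt (by simp; norm_cast)) e f]
  simp only [covD, ← christoffelB_apply, map_add, curvatureB]
  simp
  abel

/-- The general Leibniz rule has an additional (∇R)(X, Y)Z term, killed by `hpar`. Local symmetry
enters the estimates through this rule. -/
theorem covD_curvature (hg : IsMetricOn g Ω) (hp : c p ∈ Ω) {X Y Z : P → E}
    (hpar : ∀ a v w z, gCovDerivCurvature g (c p) a v w z = 0)
    (hc : DifferentiableAt ℝ c p) (hX : DifferentiableAt ℝ X p)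
    (hY : DifferentiableAt ℝ Y p) (hZ : DifferentiableAt ℝ Z p) (e : P) :
    covD g c e (fun q ↦ curvatureB g (c q) (X q) (Y q) (Z q)) p =
      curvatureB g (c p) (covD g c e X p) (Y p) (Z p)
      + curvatureB g (c p) (X p) (covD g c e Y p) (Z p)
      + curvatureB g (c p) (X p) (Y p) (covD g c e Z p) := by
  have h : HasFDerivAt (fun q ↦ curvatureB g (c q) (X q) (Y q) (Z q)) _ p :=
    ((((hg.differentiableAt_curvatureB hp).hasFDerivAt.comp p hc.hasFDerivAt).clm_apply
      hX.hasFDerivAt).clm_apply hY.hasFDerivAt).clm_apply hZ.hasFDerivAt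
  have hp' := hpar (fderiv ℝ c p e) (X p) (Y p) (Z p)
  rw [gCovDerivCurvature, hg.fderiv_gCurvature hp] at hp'
  simp only [← hg.curvatureB_apply hp] at hp'
  rw [sub_sub, sub_sub, sub_eq_zero] at hp'
  simp only [covD, h.fderiv, map_add, add_apply]
  simp
  rw [← sub_eq_zero] at hp' ⊢
  rw [← hp']
  abel

end IsMetricOn
end AlongMaps

/-! ### Evolution equations in a chart -/

section LocalFlow

variable {E : Type*} [NormedAddCommGroup E] [NormedSpace ℝ E]

/-- A curve shortening flow in coordinates: `g` is the metric, `c` the flow as a function of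
`(u, t) ∈ U`, `v` the speed and `a l` the `l`-th arc length derivative of the unit tangent. -/
structure IsLocalFlow (g : E → E →L[ℝ] E →L[ℝ] ℝ) (Ω : Set E) (U : Set (ℝ × ℝ)) (c : ℝ × ℝ → E)
    (v : ℝ × ℝ → ℝ) (a : ℕ → ℝ × ℝ → E) : Prop where
  metric : IsMetricOn g Ω
  parallel : ∀ y ∈ Ω, ∀ b v w z, gCovDerivCurvature g y b v w z = 0
  isOpen : IsOpen U
  mapsTo : MapsTo c U Ω
  contDiffOn : ContDiffOn ℝ ∞ c U
  contDiffOn_speed : ContDiffOn ℝ ∞ v U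
  speed_pos : ∀ p ∈ U, 0 < v p
  speed_smul_zero : ∀ p ∈ U, v p • a 0 p = fderiv ℝ c p (1, 0)
  unit : ∀ p ∈ U, g (c p) (a 0 p) (a 0 p) = 1
  contDiffOn_coord : ∀ l, ContDiffOn ℝ ∞ (a l) U
  speed_smul_succ : ∀ l, ∀ p ∈ U, v p • a (l + 1) p = covD g c (1, 0) (a l) p
  evolution : ∀ p ∈ U, fderiv ℝ c p (0, 1) = a 1 p

/-- The vector field represented by a monomial. -/
def FlowTerm.eval (g : E → E →L[ℝ] E →L[ℝ] ℝ) (c : ℝ × ℝ → E) (a : ℕ → ℝ × ℝ → E) :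
    FlowTerm → ℝ × ℝ → E
  | inn i j m => fun p ↦ g (c p) (a (i + 1) p) (a (j + 1) p) • a m p
  | curv i j m => fun p ↦ curvatureB g (c p) (a i p) (a (j + 1) p) (a m p)

/-- The vector field represented by a sum of monomials. -/
def evalSum (g : E → E →L[ℝ] E →L[ℝ] ℝ) (c : ℝ × ℝ → E) (a : ℕ → ℝ × ℝ → E)
    (L : List FlowTerm) (p : ℝ × ℝ) : E :=
  (L.map fun q ↦ q.eval g c a p).sum

namespace IsLocalFlow

variable {g : E → E →L[ℝ] E →L[ℝ] ℝ} {Ω : Set E} {U : Set (ℝ × ℝ)}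
  {c : ℝ × ℝ → E} {v : ℝ × ℝ → ℝ} {a : ℕ → ℝ × ℝ → E}

theorem differentiableAt {F : Type*} [NormedAddCommGroup F] [NormedSpace ℝ F]
    (h : IsLocalFlow g Ω U c v a) {f : ℝ × ℝ → F} (hf : ContDiffOn ℝ ∞ f U)
    {p : ℝ × ℝ} (hp : p ∈ U) : DifferentiableAt ℝ f p :=
  (hf.contDiffAt (h.isOpen.mem_nhds hp)).differentiableAt (by simp)

theorem contDiffOn_fderiv_apply (h : IsLocalFlow g Ω U c v a) (e : ℝ × ℝ) :
    ContDiffOn ℝ ∞ (fun p ↦ fderiv ℝ c p e) U :=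
  (h.contDiffOn.fderiv_of_isOpen h.isOpen (m := ∞) (by simp)).clm_apply contDiffOn_const

theorem evalSum_cons (q : FlowTerm) (L : List FlowTerm) :
    evalSum g c a (q :: L) = fun p ↦ q.eval g c a p + evalSum g c a L p := by
  funext p; simp [evalSum]

variable [FiniteDimensional ℝ E]

theorem fderiv_inner_fst (h : IsLocalFlow g Ω U c v a) (i j : ℕ) {p : ℝ × ℝ} (hp : p ∈ U) :
    fderiv ℝ (fun q ↦ g (c q) (a i q) (a j q)) p (1, 0) =
      v p * (g (c p) (a (i + 1) p) (a j p) + g (c p) (a i p) (a (j + 1) p)) := by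
  rw [(h.metric.fderiv_comp (h.mapsTo hp) (h.differentiableAt h.contDiffOn hp)
    (h.differentiableAt (h.contDiffOn_coord i) hp)
    (h.differentiableAt (h.contDiffOn_coord j) hp)).2, ← h.speed_smul_succ i p hp,
    ← h.speed_smul_succ j p hp]
  simp
  ring

theorem inner_zero_one (h : IsLocalFlow g Ω U c v a) {p : ℝ × ℝ} (hp : p ∈ U) :
    g (c p) (a 0 p) (a 1 p) = 0 := by
  have h1 := h.fderiv_inner_fst 0 0 hp
  have h2 : (fun q ↦ g (c q) (a 0 q) (a 0 q)) =ᶠ[nhds p] fun _ ↦ (1 : ℝ) :=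
    Filter.eventuallyEq_of_mem (h.isOpen.mem_nhds hp) h.unit
  rw [h2.fderiv_eq, h.metric.symm _ (h.mapsTo hp) (a (0 + 1) p)] at h1
  simpa [(h.speed_pos p hp).ne'] using h1

/-- Differentiate ⟨A_0, A_1⟩ = 0 in arc length and cancel the positive speed. -/
theorem inner_zero_two (h : IsLocalFlow g Ω U c v a) {p : ℝ × ℝ} (hp : p ∈ U) :
    g (c p) (a 0 p) (a 2 p) = - g (c p) (a 1 p) (a 1 p) := by
  have h1 := h.fderiv_inner_fst 0 1 hp
  have h2 : (fun q ↦ g (c q) (a 0 q) (a 1 q)) =ᶠ[nhds p] fun _ ↦ (0 : ℝ) :=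
    Filter.eventuallyEq_of_mem (h.isOpen.mem_nhds hp) fun q hq ↦ h.inner_zero_one hq
  rw [h2.fderiv_eq] at h1
  have : g (c p) (a 1 p) (a 1 p) + g (c p) (a 0 p) (a 2 p) = 0 := by
    simpa [(h.speed_pos p hp).ne'] using h1
  linarith

theorem covD_fderiv (h : IsLocalFlow g Ω U c v a) {p : ℝ × ℝ} (hp : p ∈ U) :
    covD g c (0, 1) (fun q ↦ fderiv ℝ c q (1, 0)) p = v p • a 2 p := by
  rw [h.metric.covD_fderiv_comm (h.mapsTo hp) (h.contDiffOn.contDiffAt (h.isOpen.mem_nhds hp)),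
    covD_congr h.isOpen hp h.evolution, h.speed_smul_succ 1 p hp]

/-- Differentiate v² = |c_u|² in time: D_t c_u = D_u c_t = v A_2, whose tangential component is -k²
v. -/
theorem fderiv_speed_snd (h : IsLocalFlow g Ω U c v a) {p : ℝ × ℝ} (hp : p ∈ U) :
    fderiv ℝ v p (0, 1) = - g (c p) (a 1 p) (a 1 p) * v p := by
  have hd := h.differentiableAt (h.contDiffOn_fderiv_apply (1, 0)) hp
  have h1 := (h.metric.fderiv_comp (h.mapsTo hp) (h.differentiableAt h.contDiffOn hp)
    hd hd).2 (0, 1)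
  have h2 : (fun q ↦ g (c q) (fderiv ℝ c q (1, 0)) (fderiv ℝ c q (1, 0))) =ᶠ[nhds p]
      fun q ↦ v q * v q := by
    filter_upwards [h.isOpen.mem_nhds hp] with q hq
    rw [← h.speed_smul_zero q hq]
    simp [h.unit q hq]
  have hv := h.differentiableAt h.contDiffOn_speed hp
  rw [h2.fderiv_eq, fderiv_fun_mul hv hv, h.covD_fderiv hp, ← h.speed_smul_zero p hp] at h1
  have hpos := (h.speed_pos p hp).ne'
  simp only [map_smul, smul_apply, smul_eq_mul, add_apply] at h1
  rw [h.metric.symm _ (h.mapsTo hp) (a 2 p), h.inner_zero_two hp] at h1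
  have : v p * (2 * fderiv ℝ v p (0, 1)) = v p * (2 * (- g (c p) (a 1 p) (a 1 p) * v p)) := by
    linarith
  have := mul_left_cancel₀ hpos this
  linarith

theorem contDiffOn_eval (h : IsLocalFlow g Ω U c v a) (q : FlowTerm) :
    ContDiffOn ℝ ∞ (q.eval g c a) U := by
  have ha := h.contDiffOn_coord
  cases q with
  | inn i j m =>
    exact (((h.metric.contDiffOn.comp h.contDiffOn h.mapsTo).clm_apply (ha _)).clm_apply
      (ha _)).smul (ha _)
  | curv i j m =>
    exact (((h.metric.contDiffOn_curvatureB.comp h.contDiffOn h.mapsTo).clm_apply (ha _)).clm_apply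
      (ha _)).clm_apply (ha _)

theorem contDiffOn_evalSum (h : IsLocalFlow g Ω U c v a) (L : List FlowTerm) :
    ContDiffOn ℝ ∞ (evalSum g c a L) U := by
  induction L with
  | nil => exact contDiffOn_const (c := 0)
  | cons q L ih => rw [evalSum_cons]; exact (h.contDiffOn_eval q).add ih

theorem covD_eval (h : IsLocalFlow g Ω U c v a) (q : FlowTerm) {p : ℝ × ℝ} (hp : p ∈ U) :
    covD g c (1, 0) (q.eval g c a) p = v p • evalSum g c a q.derivative p := by
  have ha := fun l ↦ h.differentiableAt (h.contDiffOn_coord l) hp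
  have hc := h.differentiableAt h.contDiffOn hp
  cases q with
  | inn i j m =>
    simp only [FlowTerm.eval, FlowTerm.derivative, evalSum]
    rw [covD_smul (h.metric.fderiv_comp (h.mapsTo hp) hc (ha _) (ha _)).1 (ha _),
      h.fderiv_inner_fst _ _ hp, ← h.speed_smul_succ m p hp]
    simp
    module
  | curv i j m =>
    simp only [FlowTerm.eval, FlowTerm.derivative, evalSum]
    rw [h.metric.covD_curvature (h.mapsTo hp) (h.parallel _ (h.mapsTo hp)) hc (ha _) (ha _) (ha _),
      ← h.speed_smul_succ m p hp, ← h.speed_smul_succ i p hp, ← h.speed_smul_succ (j + 1) p hp]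
    simp
    module

theorem covD_evalSum (h : IsLocalFlow g Ω U c v a) (L : List FlowTerm) {p : ℝ × ℝ} (hp : p ∈ U) :
    covD g c (1, 0) (evalSum g c a L) p =
      v p • evalSum g c a (L.flatMap FlowTerm.derivative) p := by
  induction L with
  | nil =>
    have : evalSum g c a [] = fun _ ↦ (0 : E) := by funext; simp [evalSum]
    simp [this, covD, ← christoffelB_apply, evalSum]
  | cons q L ih =>
    rw [evalSum_cons, covD_add (h.differentiableAt (h.contDiffOn_eval q) hp)
      (h.differentiableAt (h.contDiffOn_evalSum L) hp), ih, h.covD_eval q hp, ← smul_add]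
    simp [evalSum]

/-- The evolution equation of the derivatives of the unit tangent. -/
theorem covD_snd (h : IsLocalFlow g Ω U c v a) (l : ℕ) : ∀ p ∈ U,
    covD g c (0, 1) (a l) p = a (l + 2) p + evalSum g c a (reaction l) p := by
  induction l with
  | zero =>
    intro p hp
    have h1 := h.covD_fderiv hp
    rw [← covD_congr h.isOpen hp h.speed_smul_zero,
      covD_smul (h.differentiableAt h.contDiffOn_speed hp)
        (h.differentiableAt (h.contDiffOn_coord 0) hp), h.fderiv_speed_snd hp] at h1
    have hpos := (h.speed_pos p hp).ne'
    refine smul_right_injective E hpos ?_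
    simp only [reaction, evalSum, FlowTerm.eval, List.map_cons, List.map_nil, List.sum_cons,
      List.sum_nil, zero_add, add_zero, smul_add, ← h1]
    module
  | succ l ih =>
    intro p hp
    have hpos := (h.speed_pos p hp).ne'
    -- Apply D_t to v A_{l+1} = D_u A_l and commute. The derivative of v supplies k² A_{l+1}, and
    -- the commutator supplies R(A_0, A_1) A_l.
    have h1 := h.metric.covD_covD (h.mapsTo hp) (h.contDiffOn.contDiffAt (h.isOpen.mem_nhds hp))
      ((h.contDiffOn_coord l).contDiffAt (h.isOpen.mem_nhds hp)) (0, 1) (1, 0)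
    rw [← covD_congr h.isOpen hp (h.speed_smul_succ l), covD_congr h.isOpen hp ih,
      covD_add (h.differentiableAt (h.contDiffOn_coord _) hp)
        (h.differentiableAt (h.contDiffOn_evalSum _) hp), h.covD_evalSum _ hp,
      covD_smul (h.differentiableAt h.contDiffOn_speed hp)
        (h.differentiableAt (h.contDiffOn_coord _) hp), h.fderiv_speed_snd hp,
      ← h.speed_smul_succ (l + 2) p hp, h.evolution p hp, ← h.speed_smul_zero p hp,
      ← h.metric.curvatureB_apply (h.mapsTo hp)] at h1
    refine smul_right_injective E hpos ?_
    have h2 : evalSum g c a (reaction (l + 1)) p =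
        evalSum g c a ((reaction l).flatMap FlowTerm.derivative) p
        + (g (c p) (a 1 p) (a 1 p) • a (l + 1) p + curvatureB g (c p) (a 0 p) (a 1 p) (a l p)) := by
      simp [reaction, evalSum, FlowTerm.eval]
    simp only [map_smul, smul_apply] at h1
    rw [h2]
    simp only [smul_add]
    rw [← sub_eq_zero] at h1 ⊢
    rw [← h1]
    module

theorem fderiv_inner_snd (h : IsLocalFlow g Ω U c v a) (l : ℕ) {p : ℝ × ℝ} (hp : p ∈ U) :
    fderiv ℝ (fun q ↦ g (c q) (a l q) (a l q)) p (0, 1) =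
      2 * g (c p) (a (l + 2) p) (a l p) +
        2 * g (c p) (evalSum g c a (reaction l) p) (a l p) := by
  have ha := h.differentiableAt (h.contDiffOn_coord l) hp
  rw [(h.metric.fderiv_comp (h.mapsTo hp) (h.differentiableAt h.contDiffOn hp) ha ha).2,
    h.metric.symm _ (h.mapsTo hp) (a l p) (covD _ _ _ _ _), h.covD_snd l p hp]
  simp
  ring

end IsLocalFlow
end LocalFlow

/-! ### Charts, transition maps and the metric in coordinates -/

section ChartDerivatives

variable {E : Type*} [NormedAddCommGroup E] [NormedSpace ℝ E]
  {M : Type*} [TopologicalSpace M] [ChartedSpace E M]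

/-- The differential of the chart at `x₀`, as a linear map of the model space. -/
def chartD (x₀ x : M) : E →L[ℝ] E := mfderiv 𝓘(ℝ, E) 𝓘(ℝ, E) (extChartAt 𝓘(ℝ, E) x₀) x

/-- The differential of the inverse of the chart at `x₀`, as a linear map of the model space. -/
def chartSymmD (x₀ : M) (y : E) : E →L[ℝ] E :=
  mfderiv 𝓘(ℝ, E) 𝓘(ℝ, E) (extChartAt 𝓘(ℝ, E) x₀).symm y

section
variable {M : Type*} [TopologicalSpace M] [ChartedSpace E M]
  [RiemannianBundle (fun x : M ↦ TangentSpace 𝓘(ℝ, E) x)]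

theorem metric_eq_inner (x₀ : M) (y v w : E) :
    metric x₀ y v w = inner ℝ
      (show TangentSpace 𝓘(ℝ, E) ((extChartAt 𝓘(ℝ, E) x₀).symm y) from chartSymmD x₀ y v)
      (show TangentSpace 𝓘(ℝ, E) ((extChartAt 𝓘(ℝ, E) x₀).symm y) from chartSymmD x₀ y w) :=
  rfl

end

variable [IsManifold 𝓘(ℝ, E) ∞ M]

theorem mdifferentiableAt_chart {x₀ x : M} (hx : x ∈ (extChartAt 𝓘(ℝ, E) x₀).source) :
    MDifferentiableAt 𝓘(ℝ, E) 𝓘(ℝ, E) (extChartAt 𝓘(ℝ, E) x₀) x :=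
  mdifferentiableAt_extChartAt (by rwa [extChartAt_source] at hx)

theorem mdifferentiableAt_chart_symm {x₀ : M} {y : E} (hy : y ∈ (extChartAt 𝓘(ℝ, E) x₀).target) :
    MDifferentiableAt 𝓘(ℝ, E) 𝓘(ℝ, E) (extChartAt 𝓘(ℝ, E) x₀).symm y :=
  (mdifferentiableOn_extChartAt_symm y hy).mdifferentiableAt
    ((isOpen_extChartAt_target x₀).mem_nhds hy)

theorem chartD_chartSymmD {x₀ : M} {y : E} (hy : y ∈ (extChartAt 𝓘(ℝ, E) x₀).target) (v : E) :
    chartD x₀ ((extChartAt 𝓘(ℝ, E) x₀).symm y) (chartSymmD x₀ y v) = v := by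
  have h := mfderiv_extChartAt_comp_mfderivWithin_extChartAt_symm (I := 𝓘(ℝ, E)) hy
  have hr : range (𝓘(ℝ, E) : ModelWithCorners ℝ E E) = univ := by simp
  rw [hr, mfderivWithin_univ] at h
  exact congrArg (fun f ↦ f v) h

theorem chartSymmD_chartD {x₀ : M} {y : E} (hy : y ∈ (extChartAt 𝓘(ℝ, E) x₀).target) (v : E) :
    chartSymmD x₀ y (chartD x₀ ((extChartAt 𝓘(ℝ, E) x₀).symm y) v) = v := by
  have h := mfderivWithin_extChartAt_symm_comp_mfderiv_extChartAt (I := 𝓘(ℝ, E)) hy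
  have hr : range (𝓘(ℝ, E) : ModelWithCorners ℝ E E) = univ := by simp
  rw [hr, mfderivWithin_univ] at h
  exact congrArg (fun f ↦ f v) h

theorem chartD_bijective {x₀ x : M} (hx : x ∈ (extChartAt 𝓘(ℝ, E) x₀).source) :
    Function.Bijective (chartD (E := E) x₀ x) := by
  have hy := (extChartAt 𝓘(ℝ, E) x₀).map_source hx
  rw [← (extChartAt 𝓘(ℝ, E) x₀).left_inv hx]
  exact ⟨Function.LeftInverse.injective (chartSymmD_chartD hy),
    Function.RightInverse.surjective (chartD_chartSymmD hy)⟩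

/-- The transition map from the chart at `x₀` to the chart at `x₁`. -/
def transition (x₀ x₁ : M) (y : E) : E :=
  extChartAt 𝓘(ℝ, E) x₁ ((extChartAt 𝓘(ℝ, E) x₀).symm y)

theorem contDiffAt_transition {x₀ x₁ : M} {y : E} (hy : y ∈ (extChartAt 𝓘(ℝ, E) x₀).target)
    (hy' : (extChartAt 𝓘(ℝ, E) x₀).symm y ∈ (extChartAt 𝓘(ℝ, E) x₁).source) :
    ContDiffAt ℝ ∞ (transition x₀ x₁ : E → E) y := by
  rw [← contMDiffAt_iff_contDiffAt]
  have h1 : ContMDiffAt 𝓘(ℝ, E) 𝓘(ℝ, E) ∞ (extChartAt 𝓘(ℝ, E) x₀).symm y :=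
    (contMDiffOn_extChartAt_symm x₀).contMDiffAt ((isOpen_extChartAt_target x₀).mem_nhds hy)
  have h2 : ContMDiffAt 𝓘(ℝ, E) 𝓘(ℝ, E) ∞ (extChartAt 𝓘(ℝ, E) x₁)
      ((extChartAt 𝓘(ℝ, E) x₀).symm y) :=
    contMDiffAt_extChartAt' (by rwa [extChartAt_source] at hy')
  exact h2.comp y h1

theorem fderiv_transition {x₀ x₁ : M} {y : E} (hy : y ∈ (extChartAt 𝓘(ℝ, E) x₀).target)
    (hy' : (extChartAt 𝓘(ℝ, E) x₀).symm y ∈ (extChartAt 𝓘(ℝ, E) x₁).source) (v : E) :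
    fderiv ℝ (transition x₀ x₁ : E → E) y v =
      chartD x₁ ((extChartAt 𝓘(ℝ, E) x₀).symm y) (chartSymmD x₀ y v) := by
  have h := mfderiv_comp y (mdifferentiableAt_chart hy') (mdifferentiableAt_chart_symm hy)
  rw [mfderiv_eq_fderiv] at h
  exact congrArg (fun f ↦ f v) h

theorem eventually_mem_transition {x₀ x₁ : M} {y : E} (hy : y ∈ (extChartAt 𝓘(ℝ, E) x₀).target)
    (hy' : (extChartAt 𝓘(ℝ, E) x₀).symm y ∈ (extChartAt 𝓘(ℝ, E) x₁).source) :
    ∀ᶠ z in nhds y, z ∈ (extChartAt 𝓘(ℝ, E) x₀).target ∧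
      (extChartAt 𝓘(ℝ, E) x₀).symm z ∈ (extChartAt 𝓘(ℝ, E) x₁).source :=
  Filter.Eventually.and ((isOpen_extChartAt_target x₀).mem_nhds hy)
    ((mdifferentiableAt_chart_symm hy).continuousAt.eventually
      ((isOpen_extChartAt_source x₁).mem_nhds hy'))

variable [RiemannianBundle (fun x : M ↦ TangentSpace 𝓘(ℝ, E) x)]

theorem metric_chartD {x₀ x : M} (hx : x ∈ (extChartAt 𝓘(ℝ, E) x₀).source)
    (V W : TangentSpace 𝓘(ℝ, E) x) :
    metric x₀ (extChartAt 𝓘(ℝ, E) x₀ x) (chartD x₀ x V) (chartD x₀ x W) = inner ℝ V W := by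
  obtain ⟨y, hy, rfl⟩ : ∃ y ∈ (extChartAt 𝓘(ℝ, E) x₀).target,
      x = (extChartAt 𝓘(ℝ, E) x₀).symm y :=
    ⟨_, (extChartAt 𝓘(ℝ, E) x₀).map_source hx, ((extChartAt 𝓘(ℝ, E) x₀).left_inv hx).symm⟩
  rw [(extChartAt 𝓘(ℝ, E) x₀).right_inv hy, metric_eq_inner]
  erw [chartSymmD_chartD hy, chartSymmD_chartD hy]

theorem metric_transition {x₀ x₁ : M} {y : E} (hy : y ∈ (extChartAt 𝓘(ℝ, E) x₀).target)
    (hy' : (extChartAt 𝓘(ℝ, E) x₀).symm y ∈ (extChartAt 𝓘(ℝ, E) x₁).source) (v w : E) :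
    metric x₀ y v w = metric x₁ (transition x₀ x₁ y)
      (fderiv ℝ (transition x₀ x₁ : E → E) y v) (fderiv ℝ (transition x₀ x₁ : E → E) y w) := by
  rw [fderiv_transition hy hy', fderiv_transition hy hy', transition, metric_eq_inner]
  exact (metric_chartD hy' _ _).symm

variable [FiniteDimensional ℝ E]
  [IsContMDiffRiemannianBundle 𝓘(ℝ, E) ∞ E (fun x : M ↦ TangentSpace 𝓘(ℝ, E) x)]

theorem isMetricOn_metric (x₀ : M) :
    IsMetricOn (metric (E := E) x₀) (extChartAt 𝓘(ℝ, E) x₀).target where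
  isOpen := isOpen_extChartAt_target x₀
  symm y _ v w := by rw [metric_eq_inner, metric_eq_inner, real_inner_comm]
  pos y hy v hv := by
    rw [metric_eq_inner]
    refine real_inner_self_pos.2 fun h0 ↦ hv ?_
    have : chartSymmD x₀ y v = 0 := h0
    rw [← chartD_chartSymmD hy v, this, map_zero]
  contDiffOn := by
    refine contDiffOn_clm_apply.2 fun v ↦ contDiffOn_clm_apply.2 fun w ↦ ?_
    have key : ∀ v : E, ContMDiffOn 𝓘(ℝ, E) (𝓘(ℝ, E).prod 𝓘(ℝ, E)) ∞
        (fun y ↦ (⟨(extChartAt 𝓘(ℝ, E) x₀).symm y,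
          mfderiv 𝓘(ℝ, E) 𝓘(ℝ, E) (extChartAt 𝓘(ℝ, E) x₀).symm y v⟩ :
          TotalSpace E (fun x : M ↦ TangentSpace 𝓘(ℝ, E) x)))
        (extChartAt 𝓘(ℝ, E) x₀).target := by
      intro v
      rw [(trivializationAt E (fun x : M ↦ TangentSpace 𝓘(ℝ, E) x) x₀).contMDiffOn_iff]
      -- In the tangent bundle trivialization at x₀ the coordinate vector field is the constant v.
      · refine ⟨contMDiffOn_extChartAt_symm x₀, ?_⟩
        refine (contMDiffOn_const (c := v)).congr fun y hy ↦ ?_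
        have hs := (extChartAt 𝓘(ℝ, E) x₀).map_target hy
        rw [extChartAt_source] at hs
        have h := TangentBundle.continuousLinearMapAt_trivializationAt (I := 𝓘(ℝ, E)) hs
        refine (Trivialization.continuousLinearMapAt_apply_of_mem (R := ℝ) _ ?_ _).symm.trans ?_
        · simpa using hs
        · exact (congrArg (fun f ↦ f (chartSymmD x₀ y v)) h).trans (chartD_chartSymmD hy v)
      · intro y hy
        have hs := (extChartAt 𝓘(ℝ, E) x₀).map_target hy
        rw [Trivialization.mem_source]
        simpa using hs
    have := ContMDiffOn.inner_bundle (E := fun x : M ↦ TangentSpace 𝓘(ℝ, E) x)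
      (b := (extChartAt 𝓘(ℝ, E) x₀).symm)
      (v := fun y ↦ mfderiv 𝓘(ℝ, E) 𝓘(ℝ, E) (extChartAt 𝓘(ℝ, E) x₀).symm y v)
      (w := fun y ↦ mfderiv 𝓘(ℝ, E) 𝓘(ℝ, E) (extChartAt 𝓘(ℝ, E) x₀).symm y w) (key v) (key w)
    exact contMDiffOn_iff_contDiffOn.1 this

end ChartDerivatives

/-! ### Chart independence of the covariant derivative -/

section CovariantDerivative

variable {E : Type*} [NormedAddCommGroup E] [NormedSpace ℝ E]
  {M : Type*} [TopologicalSpace M] [ChartedSpace E M]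

theorem hasDerivAt_apply_comp {T : E → E →L[ℝ] E} {T' : E →L[ℝ] E →L[ℝ] E} {y a : ℝ → E} {y' a' : E}
    {u : ℝ} (hT : HasFDerivAt T T' (y u)) (hy : HasDerivAt y y' u) (ha : HasDerivAt a a' u) :
    HasDerivAt (fun u ↦ T (y u) (a u)) (T' y' (a u) + T (y u) a') u :=
  (hT.comp_hasDerivAt u hy).clm_apply ha

theorem coordField_eq (x₀ : M) (c : ℝ → M) (V : ∀ u, TangentSpace 𝓘(ℝ, E) (c u)) (u : ℝ) :
    coordField x₀ c V u = chartD (E := E) x₀ (c u) (V u) := rfl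

theorem coordField_smul (x₀ : M) (c : ℝ → M) (r : ℝ → ℝ) (V : ∀ u, TangentSpace 𝓘(ℝ, E) (c u))
    (u : ℝ) : coordField x₀ c (fun u ↦ r u • V u) u = r u • coordField x₀ c V u :=
  map_smul (chartD (E := E) x₀ (c u)) (r u) (V u)

variable [IsManifold 𝓘(ℝ, E) ∞ M]

theorem hasDerivWithinAt_chart_comp {x₀ : M} {c : ℝ → M} {u : ℝ} {s : Set ℝ}
    {c' : ℝ →L[ℝ] TangentSpace 𝓘(ℝ, E) (c u)}
    (hc : HasMFDerivWithinAt 𝓘(ℝ, ℝ) 𝓘(ℝ, E) c s u c')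
    (hx : c u ∈ (extChartAt 𝓘(ℝ, E) x₀).source) :
    HasDerivWithinAt (fun u' ↦ extChartAt 𝓘(ℝ, E) x₀ (c u')) (chartD x₀ (c u) (c' 1)) s u := by
  have h := (mdifferentiableAt_chart hx).hasMFDerivAt.comp_hasMFDerivWithinAt u hc
  have h' : HasFDerivWithinAt (fun u' ↦ extChartAt 𝓘(ℝ, E) x₀ (c u'))
      (chartD x₀ (c u) ∘L (show ℝ →L[ℝ] E from c')) s u :=
    hasMFDerivWithinAt_iff_hasFDerivWithinAt.1 h
  exact h'.hasDerivWithinAt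

theorem hasDerivAt_coordField_velocity {x₀ : M} {c : ℝ → M} {u : ℝ}
    (hc : MDifferentiableAt 𝓘(ℝ, ℝ) 𝓘(ℝ, E) c u) (hx : c u ∈ (extChartAt 𝓘(ℝ, E) x₀).source) :
    HasDerivAt (fun u' ↦ extChartAt 𝓘(ℝ, E) x₀ (c u')) (coordField x₀ c (velocity c) u) u := by
  rw [← hasDerivWithinAt_univ]
  exact hasDerivWithinAt_chart_comp hc.hasMFDerivAt.hasMFDerivWithinAt hx

variable [RiemannianBundle (fun x : M ↦ TangentSpace 𝓘(ℝ, E) x)]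
  [FiniteDimensional ℝ E]
  [IsContMDiffRiemannianBundle 𝓘(ℝ, E) ∞ E (fun x : M ↦ TangentSpace 𝓘(ℝ, E) x)]

/-- `covDeriv` uses the chart centred at c u, which moves with u. Iterating and differentiating it
requires the same formula in one fixed chart. -/
theorem coordField_covDeriv {x₀ : M} {c : ℝ → M} {u : ℝ} {V : ∀ u, TangentSpace 𝓘(ℝ, E) (c u)}
    (hc : MDifferentiableAt 𝓘(ℝ, ℝ) 𝓘(ℝ, E) c u) (hx : c u ∈ (extChartAt 𝓘(ℝ, E) x₀).source)
    (hV : DifferentiableAt ℝ (coordField x₀ c V) u) :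
    coordField x₀ c (covDeriv c V) u = deriv (coordField x₀ c V) u +
      christoffel x₀ (extChartAt 𝓘(ℝ, E) x₀ (c u)) (coordField x₀ c (velocity c) u)
        (coordField x₀ c V u) := by
  set y := extChartAt 𝓘(ℝ, E) x₀ (c u) with hy_def
  have hy : y ∈ (extChartAt 𝓘(ℝ, E) x₀).target := (extChartAt 𝓘(ℝ, E) x₀).map_source hx
  have hys : (extChartAt 𝓘(ℝ, E) x₀).symm y = c u := (extChartAt 𝓘(ℝ, E) x₀).left_inv hx
  have hy' : (extChartAt 𝓘(ℝ, E) x₀).symm y ∈ (extChartAt 𝓘(ℝ, E) (c u)).source := by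
    rw [hys]; exact mem_extChartAt_source (I := 𝓘(ℝ, E)) (c u)
  have hθ := contDiffAt_transition hy hy'
  have hev := eventually_mem_transition hy hy'
  have hD : ∀ {x : M}, x ∈ (extChartAt 𝓘(ℝ, E) x₀).source →
      x ∈ (extChartAt 𝓘(ℝ, E) (c u)).source → ∀ w : E,
      fderiv ℝ (transition x₀ (c u) : E → E) (extChartAt 𝓘(ℝ, E) x₀ x) (chartD x₀ x w) =
        chartD (c u) x w := by
    intro x hx1 hx2 w
    have h1 := (extChartAt 𝓘(ℝ, E) x₀).map_source hx1
    have h2 := (extChartAt 𝓘(ℝ, E) x₀).left_inv hx1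
    rw [fderiv_transition h1 (by rwa [h2])]
    have h3 := chartSymmD_chartD h1 w
    rw [h2] at h3
    rw [h3, h2]
  -- the coordinates of `V` in the chart at `c u`
  have hcoord : coordField (c u) c V =ᶠ[nhds u] fun u' ↦
      fderiv ℝ (transition x₀ (c u) : E → E) (extChartAt 𝓘(ℝ, E) x₀ (c u'))
        (coordField x₀ c V u') := by
    filter_upwards [hc.continuousAt.eventually ((isOpen_extChartAt_source x₀).mem_nhds hx),
      hc.continuousAt.eventually ((isOpen_extChartAt_source (c u)).mem_nhds
        (mem_extChartAt_source (I := 𝓘(ℝ, E)) (c u)))] with u' h1 h2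
    exact (hD h1 h2 (V u')).symm
  have hder : HasDerivAt (coordField (c u) c V)
      (fderiv ℝ (fderiv ℝ (transition x₀ (c u) : E → E)) y (coordField x₀ c (velocity c) u)
        (coordField x₀ c V u) +
        fderiv ℝ (transition x₀ (c u) : E → E) y (deriv (coordField x₀ c V) u)) u := by
    have h1 := hasDerivAt_coordField_velocity hc hx
    have h2 : HasFDerivAt (fderiv ℝ (transition x₀ (c u) : E → E))
        (fderiv ℝ (fderiv ℝ (transition x₀ (c u) : E → E)) y) y :=
      ((hθ.fderiv_right (m := 1) (by norm_cast)).differentiableAt (by simp)).hasFDerivAt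
    exact (hasDerivAt_apply_comp h2 h1 hV.hasDerivAt).congr_of_eventuallyEq hcoord
  have hsurj : Function.Surjective (fderiv ℝ (transition x₀ (c u) : E → E) y) := by
    intro w
    obtain ⟨w', rfl⟩ := (chartD_bijective (E := E) (mem_extChartAt_source (I := 𝓘(ℝ, E)) (c u))).2 w
    exact ⟨_, hD hx (mem_extChartAt_source (I := 𝓘(ℝ, E)) (c u)) w'⟩
  have htr := (isMetricOn_metric x₀).gChristoffel_transform (isMetricOn_metric (c u)) hy
    ((extChartAt 𝓘(ℝ, E) (c u)).map_source hy') hθ hsurj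
    (hev.mono fun z hz v w ↦ metric_transition hz.1 hz.2 v w)
    (coordField x₀ c (velocity c) u) (coordField x₀ c V u)
  have hty : transition x₀ (c u) y = extChartAt 𝓘(ℝ, E) (c u) (c u) := by
    rw [transition, hys]
  have hsum : deriv (coordField (c u) c V) u +
      christoffel (c u) (extChartAt 𝓘(ℝ, E) (c u) (c u))
        (coordField (c u) c (velocity c) u) (coordField (c u) c V u) =
      fderiv ℝ (transition x₀ (c u) : E → E) y (deriv (coordField x₀ c V) u +
        christoffel x₀ y (coordField x₀ c (velocity c) u) (coordField x₀ c V u)) := by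
    rw [hder.deriv, map_add]
    have e1 : ∀ W : ∀ u, TangentSpace 𝓘(ℝ, E) (c u), coordField (c u) c W u =
        fderiv ℝ (transition x₀ (c u) : E → E) y (coordField x₀ c W u) := fun W ↦
      (hD hx (mem_extChartAt_source (I := 𝓘(ℝ, E)) (c u)) (W u)).symm
    rw [e1, e1, ← hty]
    -- The symbols in a chart are by definition those of its metric field. The Hessian in their
    -- transformation law matches the one in the derivative of the transformed coordinates.
    change _ + gChristoffel (metric (c u)) _ _ _ = _ + fderiv ℝ _ y (gChristoffel (metric x₀) y _ _)
    rw [htr]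
    abel
  obtain ⟨Z, hZ⟩ := (chartD_bijective (E := E) hx).2 (deriv (coordField x₀ c V) u +
        christoffel x₀ y (coordField x₀ c (velocity c) u) (coordField x₀ c V u))
  rw [← hZ] at hsum ⊢
  rw [hD hx (mem_extChartAt_source (I := 𝓘(ℝ, E)) (c u))] at hsum
  have hinv : (chartD (E := E) (c u) (c u)).IsInvertible :=
    isInvertible_mfderiv_extChartAt (I := 𝓘(ℝ, E)) (mem_extChartAt_source (I := 𝓘(ℝ, E)) (c u))
  have : covDeriv c V u = (chartD (E := E) (c u) (c u)).inverse (chartD (c u) (c u) Z) := by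
    rw [← hsum]; rfl
  rw [coordField_eq, this]
  congr 1
  obtain ⟨e, he⟩ := hinv
  rw [← he]; simp

end CovariantDerivative

/-! ### Smoothness on a strip whose time interval may contain endpoints -/

section Strip

variable {F : Type*} [NormedAddCommGroup F] [NormedSpace ℝ F] {W : Set (ℝ × ℝ)} {J : Set ℝ}
  {f : ℝ × ℝ → F}

theorem eventually_mem_strip (hW : IsOpen W) {p : ℝ × ℝ} (hp : p ∈ W ∩ univ ×ˢ J) :
    ∀ᶠ u in nhds p.1, (u, p.2) ∈ W ∩ univ ×ˢ J := by
  have h : ContinuousAt (fun u : ℝ ↦ (u, p.2)) p.1 := by fun_prop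
  filter_upwards [h.eventually (hW.mem_nhds hp.1)] with u hu
  exact ⟨hu, mem_univ _, hp.2.2⟩

theorem hasDerivAt_fst_of_hasFDerivWithinAt (hW : IsOpen W) {p : ℝ × ℝ}
    (hp : p ∈ W ∩ univ ×ˢ J) {f' : ℝ × ℝ →L[ℝ] F} (hf : HasFDerivWithinAt f f' (W ∩ univ ×ˢ J) p) :
    HasDerivAt (fun u ↦ f (u, p.2)) (f' (1, 0)) p.1 := by
  have h1 : HasDerivAt (fun u : ℝ ↦ (u, p.2)) ((1 : ℝ), (0 : ℝ)) p.1 :=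
    (hasDerivAt_id p.1).prodMk (hasDerivAt_const p.1 p.2)
  exact hf.comp_hasDerivAt p.1 h1 (eventually_mem_strip hW hp)

theorem uniqueDiffOn_strip (hW : IsOpen W) (hJ : UniqueDiffOn ℝ J) :
    UniqueDiffOn ℝ (W ∩ univ ×ˢ J) := by
  rw [inter_comm]
  exact (uniqueDiffOn_univ.prod hJ).inter hW

theorem differentiableAt_fst (hW : IsOpen W) (hf : ContDiffOn ℝ ∞ f (W ∩ univ ×ˢ J))
    {p : ℝ × ℝ} (hp : p ∈ W ∩ univ ×ˢ J) : DifferentiableAt ℝ (fun u ↦ f (u, p.2)) p.1 :=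
  (hasDerivAt_fst_of_hasFDerivWithinAt hW hp
    ((hf.differentiableOn (by simp)) p hp).hasFDerivWithinAt).differentiableAt

/-- The strip is open in the u direction, so the ordinary u-derivative is the within-derivative
applied to (1, 0), even at an endpoint of J. -/
theorem contDiffOn_deriv_fst (hW : IsOpen W) (hJ : UniqueDiffOn ℝ J)
    (hf : ContDiffOn ℝ ∞ f (W ∩ univ ×ˢ J)) :
    ContDiffOn ℝ ∞ (fun p ↦ deriv (fun u ↦ f (u, p.2)) p.1) (W ∩ univ ×ˢ J) := by
  have h1 := (hf.fderivWithin (uniqueDiffOn_strip hW hJ) (m := ∞) (by simp)).clm_apply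
    (contDiffOn_const (c := ((1 : ℝ), (0 : ℝ))))
  refine h1.congr fun p hp ↦ ?_
  exact (hasDerivAt_fst_of_hasFDerivWithinAt hW hp
    ((hf.differentiableOn (by simp)) p hp).hasFDerivWithinAt).deriv

end Strip

/-! ### The flow and its derivatives in a fixed chart -/

section FlowCoordinates

variable {E : Type*} [NormedAddCommGroup E] [NormedSpace ℝ E]
  {M : Type*} [TopologicalSpace M] [ChartedSpace E M]

/-- The flow as a map of the angle and the time. -/
def flowMap (γ : Circle × ℝ → M) (p : ℝ × ℝ) : M := slice γ p.2 p.1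

variable (E) in
/-- The part of the space-time strip that is mapped to the domain of the chart at `x₀`. -/
def chartDomain (J : Set ℝ) (γ : Circle × ℝ → M) (x₀ : M) : Set (ℝ × ℝ) :=
  flowMap γ ⁻¹' (extChartAt 𝓘(ℝ, E) x₀).source ∩ univ ×ˢ J

variable (E) in
/-- The flow in the chart at `x₀`. -/
def flowCoord (γ : Circle × ℝ → M) (x₀ : M) (p : ℝ × ℝ) : E :=
  extChartAt 𝓘(ℝ, E) x₀ (flowMap γ p)

variable (E) in
/-- The velocity of the curves of the flow in the chart at `x₀`. -/
def velocityCoord (γ : Circle × ℝ → M) (x₀ : M) (p : ℝ × ℝ) : E :=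
  coordField x₀ (slice γ p.2) (velocity (slice γ p.2)) p.1

section

variable [RiemannianBundle (fun x : M ↦ TangentSpace 𝓘(ℝ, E) x)]

variable (E) in
/-- The derivative `D^l T/∂s^l` in the chart at `x₀`. -/
def tangentCoord (γ : Circle × ℝ → M) (x₀ : M) (l : ℕ) (p : ℝ × ℝ) : E :=
  coordField x₀ (slice γ p.2) (iterCovDerivT (slice γ p.2) l) p.1

variable (E) in
/-- The speed of the curves of the flow. -/
def flowSpeed (γ : Circle × ℝ → M) (p : ℝ × ℝ) : ℝ :=
  ‖velocity (E := E) (slice γ p.2) p.1‖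

theorem tangentCoord_zero (γ : Circle × ℝ → M) (x₀ : M) (p : ℝ × ℝ) :
    tangentCoord E γ x₀ 0 p = (flowSpeed E γ p)⁻¹ • velocityCoord E γ x₀ p :=
  coordField_smul x₀ (slice γ p.2) (fun u ↦ ‖velocity (E := E) (slice γ p.2) u‖⁻¹)
    (velocity (slice γ p.2)) p.1

theorem iterCovDerivT_succ (c : ℝ → M) (l : ℕ) :
    iterCovDerivT (E := E) c (l + 1) = covDerivS c (iterCovDerivT c l) :=
  Function.iterate_succ_apply' _ _ _

theorem IsCurveShorteningFlow.flowSpeed_pos {J : Set ℝ} {γ : Circle × ℝ → M} (h : IsCurveShorteningFlow E J γ) {p : ℝ × ℝ}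
    (hp : p.2 ∈ J) : 0 < flowSpeed E γ p :=
  norm_pos_iff.2 (h.immersed p.2 hp p.1)

end

theorem contMDiffOn_flowMap {J : Set ℝ} {γ : Circle × ℝ → M}
    (hγ : ContMDiffOn ((𝓡 1).prod 𝓘(ℝ, ℝ)) 𝓘(ℝ, E) ∞ γ (univ ×ˢ J)) :
    ContMDiffOn 𝓘(ℝ, ℝ × ℝ) 𝓘(ℝ, E) ∞ (flowMap γ) (univ ×ˢ J) := by
  have h1 : ContMDiff 𝓘(ℝ, ℝ × ℝ) 𝓘(ℝ, ℝ) ∞ (Prod.fst : ℝ × ℝ → ℝ) := contDiff_fst.contMDiff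
  have h2 : ContMDiff 𝓘(ℝ, ℝ × ℝ) 𝓘(ℝ, ℝ) ∞ (Prod.snd : ℝ × ℝ → ℝ) := contDiff_snd.contMDiff
  have h3 : ContMDiff 𝓘(ℝ, ℝ × ℝ) ((𝓡 1).prod 𝓘(ℝ, ℝ)) ∞
      (fun p : ℝ × ℝ ↦ (Circle.exp p.1, p.2)) := (contMDiff_circleExp.comp h1).prodMk h2
  exact hγ.comp h3.contMDiffOn fun p hp ↦ ⟨mem_univ _, hp.2⟩

variable {J : Set ℝ} {γ : Circle × ℝ → M}

theorem mapsTo_flowCoord (x₀ : M) :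
    MapsTo (flowCoord E γ x₀) (chartDomain E J γ x₀) (extChartAt 𝓘(ℝ, E) x₀).target :=
  fun _ hp ↦ (extChartAt 𝓘(ℝ, E) x₀).map_source hp.1

theorem exists_isOpen_chartDomain
    (hγ : ContMDiffOn ((𝓡 1).prod 𝓘(ℝ, ℝ)) 𝓘(ℝ, E) ∞ γ (univ ×ˢ J)) (x₀ : M) :
    ∃ W, IsOpen W ∧ chartDomain E J γ x₀ = W ∩ univ ×ˢ J := by
  obtain ⟨W, hW, h⟩ := continuousOn_iff'.1 (contMDiffOn_flowMap hγ).continuousOn _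
    (isOpen_extChartAt_source (I := 𝓘(ℝ, E)) x₀)
  exact ⟨W, hW, h⟩

theorem mdifferentiableAt_slice
    (hγ : ContMDiffOn ((𝓡 1).prod 𝓘(ℝ, ℝ)) 𝓘(ℝ, E) ∞ γ (univ ×ˢ J)) {t : ℝ} (ht : t ∈ J) (u : ℝ) :
    MDifferentiableAt 𝓘(ℝ, ℝ) 𝓘(ℝ, E) (slice γ t) u := by
  have h3 : ContMDiff 𝓘(ℝ, ℝ) 𝓘(ℝ, ℝ × ℝ) ∞ (fun u : ℝ ↦ (u, t)) :=
    (contDiff_id.prodMk contDiff_const).contMDiff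
  have h : ContMDiffOn 𝓘(ℝ, ℝ) 𝓘(ℝ, E) ∞ (slice γ t) univ :=
    (contMDiffOn_flowMap hγ).comp h3.contMDiffOn fun u _ ↦ ⟨mem_univ _, ht⟩
  exact (contMDiffOn_univ.1 h u).mdifferentiableAt (by simp)

variable [IsManifold 𝓘(ℝ, E) ∞ M]

theorem contDiffOn_flowCoord
    (hγ : ContMDiffOn ((𝓡 1).prod 𝓘(ℝ, ℝ)) 𝓘(ℝ, E) ∞ γ (univ ×ˢ J)) (x₀ : M) :
    ContDiffOn ℝ ∞ (flowCoord E γ x₀) (chartDomain E J γ x₀) := by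
  rw [← contMDiffOn_iff_contDiffOn]
  have h1 : ContMDiffOn 𝓘(ℝ, E) 𝓘(ℝ, E) ∞ (extChartAt 𝓘(ℝ, E) x₀)
      (extChartAt 𝓘(ℝ, E) x₀).source := by
    rw [extChartAt_source]; exact contMDiffOn_extChartAt
  exact h1.comp ((contMDiffOn_flowMap hγ).mono inter_subset_right) inter_subset_left

theorem hasDerivAt_flowCoord
    (hγ : ContMDiffOn ((𝓡 1).prod 𝓘(ℝ, ℝ)) 𝓘(ℝ, E) ∞ γ (univ ×ˢ J)) {x₀ : M} {p : ℝ × ℝ}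
    (hp : p ∈ chartDomain E J γ x₀) :
    HasDerivAt (fun u ↦ flowCoord E γ x₀ (u, p.2)) (velocityCoord E γ x₀ p) p.1 :=
  hasDerivAt_coordField_velocity (mdifferentiableAt_slice hγ hp.2.2 p.1) hp.1

theorem contDiffOn_velocityCoord (hJ : UniqueDiffOn ℝ J)
    (hγ : ContMDiffOn ((𝓡 1).prod 𝓘(ℝ, ℝ)) 𝓘(ℝ, E) ∞ γ (univ ×ˢ J)) (x₀ : M) :
    ContDiffOn ℝ ∞ (velocityCoord E γ x₀) (chartDomain E J γ x₀) := by
  obtain ⟨W, hW, h⟩ := exists_isOpen_chartDomain hγ x₀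
  have h1 := contDiffOn_flowCoord hγ x₀
  rw [h] at h1
  have h2 := contDiffOn_deriv_fst hW hJ h1
  rw [← h] at h2
  exact h2.congr fun p hp ↦ (hasDerivAt_flowCoord hγ hp).deriv.symm

variable [RiemannianBundle (fun x : M ↦ TangentSpace 𝓘(ℝ, E) x)]

theorem metric_tangentCoord {x₀ : M} {p : ℝ × ℝ}
    (hp : p ∈ chartDomain E J γ x₀) (i j : ℕ) :
    metric x₀ (flowCoord E γ x₀ p) (tangentCoord E γ x₀ i p) (tangentCoord E γ x₀ j p) =
      inner ℝ (iterCovDerivT (E := E) (slice γ p.2) i p.1)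
        (iterCovDerivT (slice γ p.2) j p.1) :=
  metric_chartD hp.1 _ _

theorem flowSpeed_sq {x₀ : M} {p : ℝ × ℝ} (hp : p ∈ chartDomain E J γ x₀) :
    metric x₀ (flowCoord E γ x₀ p) (velocityCoord E γ x₀ p) (velocityCoord E γ x₀ p) =
      flowSpeed E γ p ^ 2 :=
  (metric_chartD hp.1 _ _).trans (real_inner_self_eq_norm_sq _)

variable [FiniteDimensional ℝ E]
  [IsContMDiffRiemannianBundle 𝓘(ℝ, E) ∞ E (fun x : M ↦ TangentSpace 𝓘(ℝ, E) x)]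

theorem IsCurveShorteningFlow.contDiffOn_flowSpeed (h : IsCurveShorteningFlow E J γ)
    (hJ : UniqueDiffOn ℝ J) (x₀ : M) :
    ContDiffOn ℝ ∞ (flowSpeed E γ) (chartDomain E J γ x₀) := by
  have h1 := contDiffOn_velocityCoord hJ h.smooth x₀
  have h2 := ((((isMetricOn_metric x₀).contDiffOn.comp (contDiffOn_flowCoord h.smooth x₀)
    (mapsTo_flowCoord x₀)).clm_apply h1).clm_apply h1).sqrt fun p hp ↦ by
      have := flowSpeed_sq hp
      have h' := h.flowSpeed_pos hp.2.2
      simp only [Function.comp_apply]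
      rw [this]; positivity
  refine h2.congr fun p hp ↦ ?_
  have := flowSpeed_sq hp
  simp only [Function.comp_apply]
  rw [this, Real.sqrt_sq (h.flowSpeed_pos hp.2.2).le]

theorem IsCurveShorteningFlow.contDiffOn_tangentCoord (h : IsCurveShorteningFlow E J γ)
    (hJ : UniqueDiffOn ℝ J) (x₀ : M) (l : ℕ) :
    ContDiffOn ℝ ∞ (tangentCoord E γ x₀ l) (chartDomain E J γ x₀) ∧
    ∀ p ∈ chartDomain E J γ x₀, tangentCoord E γ x₀ (l + 1) p = (flowSpeed E γ p)⁻¹ •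
      (deriv (fun u ↦ tangentCoord E γ x₀ l (u, p.2)) p.1 +
        gChristoffel (metric x₀) (flowCoord E γ x₀ p) (velocityCoord E γ x₀ p)
          (tangentCoord E γ x₀ l p)) := by
  obtain ⟨W, hW, hWS⟩ := exists_isOpen_chartDomain h.smooth x₀
  have hinv : ContDiffOn ℝ ∞ (fun p ↦ (flowSpeed E γ p)⁻¹) (chartDomain E J γ x₀) :=
    (h.contDiffOn_flowSpeed hJ x₀).inv fun p hp ↦ (h.flowSpeed_pos hp.2.2).ne'
  -- The recursion needs the order l coordinates to be differentiable, and smoothness at order l + 1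
  -- is read off from it; the two therefore advance together.
  have hstep : ∀ l, ContDiffOn ℝ ∞ (tangentCoord E γ x₀ l) (chartDomain E J γ x₀) →
    ∀ p ∈ chartDomain E J γ x₀, tangentCoord E γ x₀ (l + 1) p = (flowSpeed E γ p)⁻¹ •
      (deriv (fun u ↦ tangentCoord E γ x₀ l (u, p.2)) p.1 +
        gChristoffel (metric x₀) (flowCoord E γ x₀ p) (velocityCoord E γ x₀ p)
          (tangentCoord E γ x₀ l p)) := by
    intro l hl p hp
    rw [hWS] at hl
    have hd := differentiableAt_fst hW hl (by rwa [← hWS])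
    have h1 := coordField_covDeriv (V := iterCovDerivT (slice γ p.2) l)
      (mdifferentiableAt_slice h.smooth hp.2.2 p.1) hp.1 hd
    rw [tangentCoord, iterCovDerivT_succ]
    refine (coordField_smul x₀ (slice γ p.2) (fun u ↦ ‖velocity (E := E) (slice γ p.2) u‖⁻¹)
      (covDeriv (slice γ p.2) (iterCovDerivT (slice γ p.2) l)) p.1).trans ?_
    rw [h1]
    rfl
  have hsm : ContDiffOn ℝ ∞ (tangentCoord E γ x₀ l) (chartDomain E J γ x₀) := by
    induction l with
    | zero =>
      exact (hinv.smul (contDiffOn_velocityCoord hJ h.smooth x₀)).congr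
        fun p _ ↦ tangentCoord_zero γ x₀ p
    | succ l ih =>
      have h1 := ih
      rw [hWS] at h1
      have h2 := contDiffOn_deriv_fst hW hJ h1
      rw [← hWS] at h2
      have h3 := (((isMetricOn_metric x₀).contDiffOn_christoffelB.comp
        (contDiffOn_flowCoord h.smooth x₀) (mapsTo_flowCoord x₀)).clm_apply
        (contDiffOn_velocityCoord hJ h.smooth x₀)).clm_apply ih
      refine (hinv.smul (h2.add h3)).congr fun p hp ↦ ?_
      rw [hstep l ih p hp]
      simp [christoffelB_apply]
  exact ⟨hsm, hstep l hsm⟩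

theorem IsCurveShorteningFlow.isLocalFlow (h : IsCurveShorteningFlow E J γ)
    (hJ : UniqueDiffOn ℝ J) (hsymm : IsLocallySymmetric E M) (x₀ : M) :
    IsLocalFlow (metric x₀) (extChartAt 𝓘(ℝ, E) x₀).target
      (chartDomain E J γ x₀ ∩ univ ×ˢ interior J) (flowCoord E γ x₀) (flowSpeed E γ)
      (tangentCoord E γ x₀) := by
  obtain ⟨W, hW, hWS⟩ := exists_isOpen_chartDomain h.smooth x₀
  have hopen : IsOpen (chartDomain E J γ x₀ ∩ univ ×ˢ interior J) := by
    have : chartDomain E J γ x₀ ∩ univ ×ˢ interior J = W ∩ univ ×ˢ interior J := by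
      rw [hWS, inter_assoc, prod_inter_prod, univ_inter,
        inter_eq_self_of_subset_right interior_subset]
    rw [this]
    exact hW.inter (isOpen_univ.prod isOpen_interior)
  have hfst : ∀ {f : ℝ × ℝ → E}, ContDiffOn ℝ ∞ f (chartDomain E J γ x₀) →
      ∀ p ∈ chartDomain E J γ x₀ ∩ univ ×ˢ interior J,
      fderiv ℝ f p (1, 0) = deriv (fun u ↦ f (u, p.2)) p.1 := by
    intro f hf p hp
    have hd : DifferentiableAt ℝ f p :=
      ((hf.mono inter_subset_left).contDiffAt (hopen.mem_nhds hp)).differentiableAt (by simp)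
    have hp1 := hp.1
    rw [hWS] at hp1
    exact (hasDerivAt_fst_of_hasFDerivWithinAt hW hp1
      hd.hasFDerivAt.hasFDerivWithinAt).deriv.symm
  have hvel : ∀ p ∈ chartDomain E J γ x₀ ∩ univ ×ˢ interior J,
      fderiv ℝ (flowCoord E γ x₀) p (1, 0) = velocityCoord E γ x₀ p := fun p hp ↦ by
    rw [hfst (contDiffOn_flowCoord h.smooth x₀) p hp, (hasDerivAt_flowCoord h.smooth hp.1).deriv]
  exact
  { metric := isMetricOn_metric x₀
    parallel := fun y hy b v w z ↦ hsymm x₀ y hy b v w z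
    isOpen := hopen
    mapsTo := fun p hp ↦ mapsTo_flowCoord x₀ hp.1
    contDiffOn := (contDiffOn_flowCoord h.smooth x₀).mono inter_subset_left
    contDiffOn_speed := (h.contDiffOn_flowSpeed hJ x₀).mono inter_subset_left
    speed_pos := fun p hp ↦ h.flowSpeed_pos hp.1.2.2
    speed_smul_zero := fun p hp ↦ by
      rw [hvel p hp, tangentCoord_zero, smul_smul,
        mul_inv_cancel₀ (h.flowSpeed_pos hp.1.2.2).ne', one_smul]
    unit := fun p hp ↦ by
      have hpos := h.flowSpeed_pos (p := p) hp.1.2.2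
      simp only [tangentCoord_zero, map_smul, smul_apply, smul_eq_mul]
      rw [flowSpeed_sq hp.1]
      field_simp
    contDiffOn_coord := fun l ↦ (h.contDiffOn_tangentCoord hJ x₀ l).1.mono inter_subset_left
    speed_smul_succ := fun l p hp ↦ by
      have h1 := h.contDiffOn_tangentCoord hJ x₀ l
      rw [h1.2 p hp.1, smul_smul, mul_inv_cancel₀ (h.flowSpeed_pos hp.1.2.2).ne', one_smul, covD,
        hfst h1.1 p hp, hvel p hp]
    evolution := fun p hp ↦ by
      have hd : DifferentiableAt ℝ (flowCoord E γ x₀) p :=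
        (((contDiffOn_flowCoord h.smooth x₀).mono inter_subset_left).contDiffAt
          (hopen.mem_nhds hp)).differentiableAt (by simp)
      have h1 : HasDerivAt (fun t : ℝ ↦ (p.1, t)) ((0 : ℝ), (1 : ℝ)) p.2 :=
        (hasDerivAt_const p.2 p.1).prodMk (hasDerivAt_id p.2)
      have h2 : HasDerivAt (fun t ↦ flowCoord E γ x₀ (p.1, t))
          (fderiv ℝ (flowCoord E γ x₀) p (0, 1)) p.2 :=
        HasFDerivAt.comp_hasDerivAt (f := fun t : ℝ ↦ (p.1, t)) p.2 hd.hasFDerivAt h1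
      -- At an interior time the derivative within J is a full derivative.
      have h3 := (hasDerivWithinAt_chart_comp (h.evolution p.2 hp.1.2.2 p.1) hp.1.1).hasDerivAt
        (mem_interior_iff_mem_nhds.1 hp.2.2)
      rw [h2.unique h3]
      change chartD (E := E) x₀ _ ((1 : ℝ) • iterCovDerivT (E := E) (slice γ p.2) 1 p.1) = _
      rw [one_smul]
      rfl }

end FlowCoordinates

/-! ### From Condition (Λ) to bounds on the reaction -/

section CurvatureBound

variable {E : Type*} [NormedAddCommGroup E] [NormedSpace ℝ E]
  {g : E → E →L[ℝ] E →L[ℝ] ℝ} {Ω : Set E}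

theorem IsMetricOn.nonneg (hg : IsMetricOn g Ω) {y : E} (hy : y ∈ Ω) (v : E) : 0 ≤ g y v v := by
  by_cases h : v = 0
  · simp [h]
  · exact (hg.pos y hy v h).le

theorem IsMetricOn.exists_unit (hg : IsMetricOn g Ω) {y : E} (hy : y ∈ Ω) {v : E} (hv : v ≠ 0) :
    ∃ w, g y w w = 1 ∧ v = √(g y v v) • w := by
  have hpos := hg.pos y hy v hv
  have hs : 0 < √(g y v v) := Real.sqrt_pos.2 hpos
  refine ⟨(√(g y v v))⁻¹ • v, ?_, by rw [smul_smul, mul_inv_cancel₀ hs.ne', one_smul]⟩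
  simp only [map_smul, smul_apply, smul_eq_mul]
  rw [← mul_assoc, ← mul_inv, Real.mul_self_sqrt hpos.le, inv_mul_cancel₀ hpos.ne']

/-- Homogeneity extends the bound from unit vectors to all vectors, and replacing W by -W makes the
upper bound two-sided. -/
theorem IsMetricOn.abs_curvature_le (hg : IsMetricOn g Ω) {y : E} (hy : y ∈ Ω) {Λ : ℝ}
    {R : E →L[ℝ] E →L[ℝ] E →L[ℝ] E}
    (hR : ∀ X Y Z W, g y X X = 1 → g y Y Y = 1 → g y Z Z = 1 → g y W W = 1 →
      g y (R X Y Z) W ≤ Λ) (X Y Z W : E) :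
    |g y (R X Y Z) W| ≤
      Λ * (√(g y X X) * √(g y Y Y) * √(g y Z Z) * √(g y W W)) := by
  have key : ∀ W, g y (R X Y Z) W ≤ Λ * (√(g y X X) * √(g y Y Y) * √(g y Z Z) * √(g y W W)) := by
    intro W
    by_cases hX : X = 0
    · simp [hX]
    by_cases hY : Y = 0
    · simp [hY]
    by_cases hZ : Z = 0
    · simp [hZ]
    by_cases hW : W = 0
    · simp [hW]
    obtain ⟨X', hX1, hX2⟩ := hg.exists_unit hy hX
    obtain ⟨Y', hY1, hY2⟩ := hg.exists_unit hy hY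
    obtain ⟨Z', hZ1, hZ2⟩ := hg.exists_unit hy hZ
    obtain ⟨W', hW1, hW2⟩ := hg.exists_unit hy hW
    have h := hR X' Y' Z' W' hX1 hY1 hZ1 hW1
    have e : g y (R X Y Z) W = (√(g y X X) * √(g y Y Y) * √(g y Z Z) * √(g y W W)) *
        g y (R X' Y' Z') W' := by
      conv_lhs => rw [hX2, hY2, hZ2, hW2]
      simp only [map_smul, smul_apply, smul_eq_mul]
      ring
    rw [e, mul_comm Λ]
    gcongr
  refine abs_le.2 ⟨?_, key W⟩
  have := key (-W)
  simp only [map_neg, neg_apply, neg_neg] at this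
  linarith

theorem IsLocalFlow.abs_reaction_le [FiniteDimensional ℝ E] {U : Set (ℝ × ℝ)} {c : ℝ × ℝ → E}
    {v : ℝ × ℝ → ℝ} {a : ℕ → ℝ × ℝ → E} (h : IsLocalFlow g Ω U c v a) {Λ : ℝ}
    (hR : ∀ y ∈ Ω, ∀ X Y Z W, g y X X = 1 → g y Y Y = 1 → g y Z Z = 1 → g y W W = 1 →
      g y (gCurvature g y X Y Z) W ≤ Λ) {p : ℝ × ℝ} (hp : p ∈ U) (l : ℕ) (L : List FlowTerm) :
    |g (c p) (evalSum g c a L p) (a l p)| ≤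
      (L.map (FlowTerm.bound Λ (fun i j ↦ g (c p) (a i p) (a j p)) l)).sum := by
  have hy := h.mapsTo hp
  induction L with
  | nil => simp [evalSum]
  | cons q L ih =>
    rw [evalSum_cons, List.map_cons, List.sum_cons]
    simp only [map_add, add_apply]
    refine (abs_add_le _ _).trans (add_le_add ?_ ih)
    cases q with
    | inn i j m => simp [FlowTerm.eval, FlowTerm.bound, abs_mul]
    | curv i j m =>
      refine h.metric.abs_curvature_le hy (R := curvatureB g (c p)) ?_ _ _ _ _
      intro X Y Z W hX hY hZ hW
      rw [h.metric.curvatureB_apply hy]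
      exact hR _ hy X Y Z W hX hY hZ hW

end CurvatureBound

/-! ### Periodicity in the angle -/

section Periodicity

variable {E : Type*} [NormedAddCommGroup E] [NormedSpace ℝ E]
  {M : Type*} [TopologicalSpace M] [ChartedSpace E M] {J : Set ℝ} {γ : Circle × ℝ → M}

theorem flowMap_periodic {M : Type*} {γ : Circle × ℝ → M} (u t : ℝ) : flowMap γ (u + 2 * Real.pi, t) = flowMap γ (u, t) := by
  simp only [flowMap, slice]
  rw [Circle.periodic_exp u]

theorem flowCoord_periodic (x₀ : M) (u t : ℝ) :
    flowCoord E γ x₀ (u + 2 * Real.pi, t) = flowCoord E γ x₀ (u, t) := by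
  rw [flowCoord, flowCoord, flowMap_periodic]

theorem mem_chartDomain_periodic {x₀ : M} {u t : ℝ} (h : (u, t) ∈ chartDomain E J γ x₀) :
    (u + 2 * Real.pi, t) ∈ chartDomain E J γ x₀ := by
  refine ⟨?_, mem_univ _, h.2.2⟩
  rw [mem_preimage, flowMap_periodic]
  exact h.1

variable [IsManifold 𝓘(ℝ, E) ∞ M]

/-- Vectors at u and u + 2π have formally different tangent spaces as types, so they are compared
through their coordinates in one chart. -/
theorem velocityCoord_periodic
    (hγ : ContMDiffOn ((𝓡 1).prod 𝓘(ℝ, ℝ)) 𝓘(ℝ, E) ∞ γ (univ ×ˢ J)) {x₀ : M} {u t : ℝ}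
    (h : (u, t) ∈ chartDomain E J γ x₀) :
    velocityCoord E γ x₀ (u + 2 * Real.pi, t) = velocityCoord E γ x₀ (u, t) := by
  rw [← (hasDerivAt_flowCoord hγ h).deriv,
    ← (hasDerivAt_flowCoord hγ (mem_chartDomain_periodic h)).deriv]
  dsimp only
  rw [← deriv_comp_add_const]
  simp only [flowCoord_periodic]

variable [RiemannianBundle (fun x : M ↦ TangentSpace 𝓘(ℝ, E) x)]

theorem flowSpeed_periodic
    (hγ : ContMDiffOn ((𝓡 1).prod 𝓘(ℝ, ℝ)) 𝓘(ℝ, E) ∞ γ (univ ×ˢ J)) {x₀ : M} {u t : ℝ}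
    (h : (u, t) ∈ chartDomain E J γ x₀) :
    flowSpeed E γ (u + 2 * Real.pi, t) = flowSpeed E γ (u, t) := by
  have h1 := flowSpeed_sq (mem_chartDomain_periodic h)
  rw [velocityCoord_periodic hγ h, flowCoord_periodic, flowSpeed_sq h] at h1
  exact ((pow_left_inj₀ (norm_nonneg _) (norm_nonneg _) two_ne_zero).1 h1).symm

variable [FiniteDimensional ℝ E]
  [IsContMDiffRiemannianBundle 𝓘(ℝ, E) ∞ E (fun x : M ↦ TangentSpace 𝓘(ℝ, E) x)]

theorem IsCurveShorteningFlow.tangentCoord_periodic (h : IsCurveShorteningFlow E J γ)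
    (hJ : UniqueDiffOn ℝ J) {x₀ : M} (l : ℕ) : ∀ u t, (u, t) ∈ chartDomain E J γ x₀ →
    tangentCoord E γ x₀ l (u + 2 * Real.pi, t) = tangentCoord E γ x₀ l (u, t) := by
  induction l with
  | zero =>
    intro u t hut
    rw [tangentCoord_zero, tangentCoord_zero, flowSpeed_periodic h.smooth hut,
      velocityCoord_periodic h.smooth hut]
  | succ l ih =>
    intro u t hut
    have h1 := (h.contDiffOn_tangentCoord hJ x₀ l).2
    obtain ⟨W, hW, hWS⟩ := exists_isOpen_chartDomain h.smooth x₀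
    have hev : (fun x ↦ tangentCoord E γ x₀ l (x + 2 * Real.pi, t)) =ᶠ[nhds u]
        fun x ↦ tangentCoord E γ x₀ l (x, t) := by
      filter_upwards [eventually_mem_strip hW (show (u, t) ∈ _ from hWS ▸ hut)] with x hx
      exact ih x t (hWS ▸ hx)
    rw [h1 _ hut, h1 _ (mem_chartDomain_periodic hut), flowSpeed_periodic h.smooth hut,
      velocityCoord_periodic h.smooth hut, flowCoord_periodic, ih u t hut, ← hev.deriv_eq]
    dsimp only
    rw [deriv_comp_add_const (f := fun x ↦ tangentCoord E γ x₀ l (x, t))]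

end Periodicity

/-! ### The Gram functions form a scalar flow -/

section ScalarFlow

variable {E : Type*} [NormedAddCommGroup E] [NormedSpace ℝ E]
  {M : Type*} [TopologicalSpace M] [ChartedSpace E M]
  [RiemannianBundle (fun x : M ↦ TangentSpace 𝓘(ℝ, E) x)]

variable (E) in
/-- The inner products `⟨D^i T/∂s^i, D^j T/∂s^j⟩` along the flow. -/
def gram (γ : Circle × ℝ → M) (i j : ℕ) (u t : ℝ) : ℝ :=
  inner ℝ (iterCovDerivT (E := E) (slice γ t) i u) (iterCovDerivT (E := E) (slice γ t) j u)

theorem gram_self (γ : Circle × ℝ → M) (l : ℕ) (u t : ℝ) :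
    gram E γ l l u t = ‖iterCovDerivT (E := E) (slice γ t) l u‖ ^ 2 :=
  real_inner_self_eq_norm_sq _

theorem abs_gram_le (γ : Circle × ℝ → M) (i j : ℕ) (u t : ℝ) :
    |gram E γ i j u t| ≤ √(gram E γ i i u t) * √(gram E γ j j u t) := by
  rw [gram_self, gram_self, Real.sqrt_sq (norm_nonneg _), Real.sqrt_sq (norm_nonneg _)]
  exact abs_real_inner_le_norm _ _

variable {J : Set ℝ} {γ : Circle × ℝ → M} [IsManifold 𝓘(ℝ, E) ∞ M]

theorem gram_eq_metric {x₀ : M} {p : ℝ × ℝ} (hp : p ∈ chartDomain E J γ x₀) (i j : ℕ) :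
    gram E γ i j p.1 p.2 = metric x₀ (flowCoord E γ x₀ p) (tangentCoord E γ x₀ i p)
      (tangentCoord E γ x₀ j p) :=
  (metric_tangentCoord hp i j).symm

variable [FiniteDimensional ℝ E]
  [IsContMDiffRiemannianBundle 𝓘(ℝ, E) ∞ E (fun x : M ↦ TangentSpace 𝓘(ℝ, E) x)]

theorem IsCurveShorteningFlow.contDiffOn_metric (h : IsCurveShorteningFlow E J γ)
    (hJ : UniqueDiffOn ℝ J) (x₀ : M) (i j : ℕ) :
    ContDiffOn ℝ ∞ (fun p ↦ metric x₀ (flowCoord E γ x₀ p) (tangentCoord E γ x₀ i p)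
      (tangentCoord E γ x₀ j p)) (chartDomain E J γ x₀) :=
  (((isMetricOn_metric x₀).contDiffOn.comp (contDiffOn_flowCoord h.smooth x₀)
    (mapsTo_flowCoord x₀)).clm_apply (h.contDiffOn_tangentCoord hJ x₀ i).1).clm_apply
    (h.contDiffOn_tangentCoord hJ x₀ j).1

theorem hasDerivAt_fst_of_differentiableAt {f : ℝ × ℝ → ℝ} {u t : ℝ}
    (hf : DifferentiableAt ℝ f (u, t)) :
    HasDerivAt (fun x ↦ f (x, t)) (fderiv ℝ f (u, t) (1, 0)) u :=
  HasFDerivAt.comp_hasDerivAt (f := fun x : ℝ ↦ (x, t)) u hf.hasFDerivAt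
    ((hasDerivAt_id u).prodMk (hasDerivAt_const u t))

theorem hasDerivAt_snd_of_differentiableAt {f : ℝ × ℝ → ℝ} {u t : ℝ}
    (hf : DifferentiableAt ℝ f (u, t)) :
    HasDerivAt (fun x ↦ f (u, x)) (fderiv ℝ f (u, t) (0, 1)) t :=
  HasFDerivAt.comp_hasDerivAt (f := fun x : ℝ ↦ (u, x)) t hf.hasFDerivAt
    ((hasDerivAt_const t u).prodMk (hasDerivAt_id t))

/-- The inner products of the derivatives of the unit tangent along a curve shortening flow in a
locally symmetric space form a scalar flow. -/
theorem IsCurveShorteningFlow.isScalarFlow (h : IsCurveShorteningFlow E J γ)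
    (hJ : UniqueDiffOn ℝ J) (hsymm : IsLocallySymmetric E M) {Λ : ℝ}
    (hcond : ConditionLambda E M Λ) :
    IsScalarFlow Λ J (gram E γ) (fun u t ↦ flowSpeed E γ (u, t)) := by
  have hmem : ∀ u, ∀ t ∈ J, (u, t) ∈ chartDomain E J γ (slice γ t u) := fun u t ht ↦
    ⟨mem_extChartAt_source (I := 𝓘(ℝ, E)) (slice γ t u), mem_univ _, ht⟩
  have hmem' : ∀ u, ∀ t ∈ interior J, (u, t) ∈ chartDomain E J γ (slice γ t u) ∩
      univ ×ˢ interior J := fun u t ht ↦ ⟨hmem u t (interior_subset ht), mem_univ _, ht⟩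
  have hloc := fun x₀ ↦ h.isLocalFlow hJ hsymm x₀
  have hdiff : ∀ i j u, ∀ t ∈ interior J, DifferentiableAt ℝ
      (fun p ↦ metric (slice γ t u) (flowCoord E γ (slice γ t u) p)
        (tangentCoord E γ (slice γ t u) i p) (tangentCoord E γ (slice γ t u) j p)) (u, t) :=
    fun i j u t ht ↦ (hloc _).differentiableAt
      ((h.contDiffOn_metric hJ _ i j).mono inter_subset_left) (hmem' u t ht)
  -- The Gram functions are defined without charts, so near each point they may be differentiated in
  -- the chart centred at its image.
  have heq : ∀ i j u, ∀ t ∈ interior J, (fun p : ℝ × ℝ ↦ gram E γ i j p.1 p.2) =ᶠ[nhds (u, t)]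
      (fun p ↦ metric (slice γ t u) (flowCoord E γ (slice γ t u) p)
        (tangentCoord E γ (slice γ t u) i p) (tangentCoord E γ (slice γ t u) j p)) :=
    fun i j u t ht ↦ Filter.eventuallyEq_of_mem ((hloc (slice γ t u)).isOpen.mem_nhds (hmem' u t ht))
      fun p hp ↦ gram_eq_metric hp.1 i j
  have hgd : ∀ i j u, ∀ t ∈ interior J,
      DifferentiableAt ℝ (fun p : ℝ × ℝ ↦ gram E γ i j p.1 p.2) (u, t) :=
    fun i j u t ht ↦ (hdiff i j u t ht).congr_of_eventuallyEq (heq i j u t ht)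
  exact
  { continuousOn := fun i j p hp ↦ by
      obtain ⟨W, hW, hWS⟩ := exists_isOpen_chartDomain h.smooth (slice γ p.2 p.1)
      have hpc := hmem p.1 p.2 hp.2
      have h1 : ContinuousOn (fun p : ℝ × ℝ ↦ gram E γ i j p.1 p.2)
          (chartDomain E J γ (slice γ p.2 p.1)) :=
        (h.contDiffOn_metric hJ (slice γ p.2 p.1) i j).continuousOn.congr
          fun q hq ↦ gram_eq_metric hq i j
      refine (h1 p hpc).mono_of_mem_nhdsWithin ?_
      have hpW : p ∈ W ∩ univ ×ˢ J := hWS ▸ hpc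
      rw [hWS, inter_comm]
      exact inter_mem_nhdsWithin _ (hW.mem_nhds hpW.1)
    periodic := fun i j t ht u ↦ by
      have hut := hmem u t ht
      have e1 := gram_eq_metric hut i j
      have e2 := gram_eq_metric (mem_chartDomain_periodic hut) i j
      rw [h.tangentCoord_periodic hJ i u t hut, h.tangentCoord_periodic hJ j u t hut,
        flowCoord_periodic, ← e1] at e2
      exact e2
    symm := fun i j u t ↦ real_inner_comm _ _
    nonneg := fun l u t ↦ real_inner_self_nonneg
    abs_le := fun i j u t ↦ abs_gram_le γ i j u t
    zero_zero := fun t ht u ↦ by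
      have := gram_eq_metric (hmem u t (interior_subset ht)) 0 0
      rw [(hloc _).unit _ (hmem' u t ht)] at this
      exact this
    zero_one := fun t ht u ↦ by
      have := gram_eq_metric (hmem u t (interior_subset ht)) 0 1
      rw [(hloc _).inner_zero_one (hmem' u t ht)] at this
      exact this
    zero_two := fun t ht u ↦ by
      have := gram_eq_metric (hmem u t (interior_subset ht)) 0 2
      rw [(hloc _).inner_zero_two (hmem' u t ht),
        ← gram_eq_metric (hmem u t (interior_subset ht)) 1 1] at this
      exact this
    speed_pos := fun t ht u ↦ h.flowSpeed_pos (p := (u, t)) (interior_subset ht)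
    differentiableAt_speed := fun t ht u ↦
      (hasDerivAt_fst_of_differentiableAt ((hloc (slice γ t u)).differentiableAt
        (hloc (slice γ t u)).contDiffOn_speed (hmem' u t ht))).differentiableAt
    hasDerivAt_fst := fun i j t ht u ↦ by
      have h1 := hasDerivAt_fst_of_differentiableAt (hgd i j u t ht)
      rw [(heq i j u t ht).fderiv_eq, (hloc _).fderiv_inner_fst i j (hmem' u t ht),
        ← gram_eq_metric (hmem u t (interior_subset ht)),
        ← gram_eq_metric (hmem u t (interior_subset ht))] at h1
      exact h1
    hasDerivAt_snd := fun l t ht u ↦ by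
      have h1 := hasDerivAt_snd_of_differentiableAt (hgd l l u t ht)
      rw [(heq l l u t ht).fderiv_eq, (hloc _).fderiv_inner_snd l (hmem' u t ht),
        ← gram_eq_metric (hmem u t (interior_subset ht))] at h1
      refine ⟨_, ?_, h1⟩
      refine ((hloc _).abs_reaction_le (fun y hy X Y Z W ↦ hcond _ y hy X Y Z W)
        (hmem' u t ht) l (reaction l)).trans (le_of_eq ?_)
      simp only [← gram_eq_metric (hmem u t (interior_subset ht))] }

end ScalarFlow

/-! ### Passage to the final time and conclusion -/

theorem uniqueDiffOn_of_lt {J : Set ℝ} (hJ : J.OrdConnected) {a b : ℝ} (ha : a ∈ J) (hb : b ∈ J)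
    (hab : a < b) : UniqueDiffOn ℝ J := by
  refine uniqueDiffOn_convex hJ.convex ?_
  have : Ioo a b ⊆ interior J :=
    interior_maximal (Ioo_subset_Icc_self.trans (hJ.out ha hb)) isOpen_Ioo
  exact (nonempty_Ioo.2 hab).mono this

/-- The time t₁ may be an endpoint of J, where no two-sided time derivative is available. Continuity
of the Gram functions up to it suffices. -/
theorem EstimateSetting.le_right {Λ : ℝ} {J : Set ℝ} {G : ℕ → ℕ → ℝ → ℝ → ℝ} {v : ℝ → ℝ → ℝ}
    {t₀ t₁ K₀ : ℝ} (h : EstimateSetting Λ J G v t₀ t₁ K₀) (hlt : t₀ < t₁) {f : ℝ → ℝ}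
    (hf : Continuous f) (l : ℕ) (u : ℝ) {C : ℝ} (hC : ∀ t ∈ Ioo t₀ t₁, f t * G l l u t ≤ C) :
    f t₁ * G l l u t₁ ≤ C := by
  have hc : ContinuousOn (fun t ↦ f t * G l l u t) (Icc t₀ t₁) := by
    refine hf.continuousOn.mul ?_
    exact (h.flow.continuousOn l l).comp (f := fun t : ℝ ↦ (u, t)) (by fun_prop)
      fun t ht ↦ ⟨mem_univ _, h.Icc_subset ht⟩
  have hmem : t₁ ∈ closure (Ioo t₀ t₁) := by
    rw [closure_Ioo hlt.ne]; exact ⟨hlt.le, le_rfl⟩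
  have hw : (nhdsWithin t₁ (Ioo t₀ t₁)).NeBot := mem_closure_iff_nhdsWithin_neBot.1 hmem
  exact le_of_tendsto ((hc t₁ ⟨hlt.le, le_rfl⟩).mono Ioo_subset_Icc_self)
    (Filter.eventually_of_mem self_mem_nhdsWithin hC)

end CSF

end

theorem theorem6 (Λ : ℝ) (hΛ : 0 < Λ) :
    ∃ c : ℕ → ℝ,
      ∀ (E : Type*) [NormedAddCommGroup E] [NormedSpace ℝ E] [FiniteDimensional ℝ E]
        (M : Type*) [TopologicalSpace M] [T2Space M] [ChartedSpace E M]
        [IsManifold 𝓘(ℝ, E) ∞ M]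
        [RiemannianBundle (fun x : M ↦ TangentSpace 𝓘(ℝ, E) x)]
        [IsContMDiffRiemannianBundle 𝓘(ℝ, E) ∞ E (fun x : M ↦ TangentSpace 𝓘(ℝ, E) x)],
        CSF.IsLocallySymmetric E M → CSF.ConditionLambda E M Λ →
        ∀ (J : Set ℝ) (γ : Circle × ℝ → M), J.OrdConnected →
          CSF.IsCurveShorteningFlow E J γ →
          ∀ t₀ ∈ J, ∀ M₀ : ℝ,
            IsGreatest
              (range fun u : ℝ ↦ ‖CSF.iterCovDerivT (E := E) (CSF.slice γ t₀) 1 u‖ ^ 2) M₀ →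
            ∀ t ∈ J, t₀ < t →
              t ≤ t₀ + 1 / (2 * Λ) * Real.log (1 + Λ / (4 * M₀ + Λ + 1)) →
              ∀ u : ℝ,
                (∀ l : ℕ, 1 ≤ l →
                  ‖CSF.iterCovDerivT (E := E) (CSF.slice γ t) l u‖ ^ 2
                    ≤ c l * M₀ / (t - t₀) ^ (l - 1)) ∧
                ‖CSF.iterCovDerivT (E := E) (CSF.slice γ t) 1 u‖ ^ 2 ≤ 2 * M₀ := by
  have exists_bound := fun n : ℕ ↦ CSF.exists_derivative_bound (n + 1) (by omega)
  choose K hK hbound using exists_bound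
  -- `K n` bounds the orders 1 to n + 1, hence the shift.
  refine ⟨fun l ↦ K (l - 1), ?_⟩
  intro E _ _ _ M _ _ _ _ _ _ hsymm hcond J γ hJ hγ t₀ ht₀ M₀ hM₀ t ht hlt htle u
  have hset : CSF.EstimateSetting Λ J (CSF.gram E γ) (fun u t ↦ CSF.flowSpeed E γ (u, t))
      t₀ t M₀ :=
    { flow := hγ.isScalarFlow (CSF.uniqueDiffOn_of_lt hJ ht₀ ht hlt) hsymm hcond
      pos := hΛ
      ordConnected := hJ
      left_mem := ht₀
      right_mem := ht
      nonneg := by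
        obtain ⟨x, hx⟩ := hM₀.1
        rw [← hx]; positivity
      initial := fun x ↦ by
        rw [CSF.gram_self]
        exact hM₀.2 ⟨x, rfl⟩
      time_le := htle }
  constructor
  · intro l hl
    have hτ : 0 < t - t₀ := sub_pos.2 hlt
    rw [← CSF.gram_self, le_div_iff₀ (by positivity), mul_comm]
    refine hset.le_right hlt (f := fun s ↦ (s - t₀) ^ (l - 1)) (by fun_prop) l u fun s hs ↦ ?_
    exact hbound (l - 1) Λ J _ _ t₀ t M₀ hset s hs u l hl (by omega)
  · rw [← CSF.gram_self, ← one_mul (CSF.gram E γ 1 1 u t)]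
    refine hset.le_right hlt (f := fun _ ↦ 1) continuous_const 1 u fun s hs ↦ ?_
    rw [one_mul]
    exact hset.curvature_le hs u
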